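/- Let $d,D\ge 2$ and $h,a,b\ge 1$ be integers. **Ensemble.** On a lattice with $m$ rows and $n$ columns, the random isometric tensor network state (isoTNS) $|\psi\rangle$ with physical dimension $d$ and bond dimension $D$ is defined as follows. Each site carries an independent Haar-random unitary $U\in U(dD^2)$ on $\mathbb C^d\otimes\mathbb C^D\otimes\mathbb C^D$ (physical system, horizontal bond, vertical bond). The tensor of the site is the isometry $|l,v\rangle\mapsto U|0,l,v\rangle$, from the bonds entering it from the left and from below to its physical system and the bonds leaving it to the right and upwards. The bonds entering the first column and the bottom row are initialized in $|0\rangle$. The bonds leaving the last column and the top row belong to the physical space of the boundary sites. All inner bonds are contracted. (The bottom-left site is the orthogonality center; its row and column form the orthogonality hypersurface.) **Subsystems.** Let $n=c+a+r+b+f$ with $m>h$ and $f\ge 1$. Let $A$ consist of the sites in the $h$ lowest rows and in the $a$ consecutive columns that follow the first $c$ columns. Let $B$ consist of the sites in the $h$ lowest rows and in the $b$ consecutive columns that follow the first $c+a+r$ columns. Let $\varrho_A$, $\varrho_B$, $\varrho_{AB}$ be the marginals of $|\psi\rangle\langle\psi|$. The average of the Rényi-2 mutual information $I_2(A:B)=S_2(\varrho_A)+S_2(\varrho_B)-S_2(\varrho_{AB})$,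 $S_2(\varrho)=-\log\operatorname{tr}(\varrho^2)$, is taken in the annealed sense, in which $\mathbb E\log$ is replaced by $\log\mathbb E$: $$\mathbb E I_2(A:B):=\log\mathbb E\operatorname{tr}(\varrho_{AB}^2)-\log\mathbb E\operatorname{tr}(\varrho_A^2)-\log\mathbb E\operatorname{tr}(\varrho_B^2).$$ **Transfer matrix.** For $\rho,\tau,\theta,\nu\in S_2$ put $$T_\rho(\tau;\theta,\nu)=\sum_{\sigma\in S_2}\mathrm{Wg}(\sigma\tau^{-1},dD^2)\,d^{\#(\sigma\rho)}D^{\#(\sigma\theta^{-1})}D^{\#(\sigma\nu^{-1})},$$ where $\#$ is the number of cycles (fixed points included) and $\mathrm{Wg}(\sigma\tau^{-1},q)=(G^{-1})_{\sigma\tau}$ with $G_{\sigma\tau}=q^{\#(\sigma\tau^{-1})}$. The $S_2$ transfer matrix of height $h$ for the trivial permutation $e$ is the $2^h\times 2^h$ matrix with rows $(\tau_1,\dots,\tau_h)\in S_2^h$, columns $(\theta_1,\dots,\theta_h)\in S_2^h$ and entries $$(\mathcal T_e)_{\tau,\theta}=\prod_{i=1}^{h}T_e(\tau_i;\theta_i,\tau_{i+1}),\qquad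 \tau_{h+1}:=e.$$ Put $$\lambda_2=\frac{dD^3-dD}{d^2D^4-1},\qquad \xi_{2\mathrm D}=-\left[\log\lambda_2\right]^{-1}.$$ **Statement.** For every height $h$ the following hold. 1. $0<\lambda_2<1$. Both $1$ and $\lambda_2$ are eigenvalues of $\mathcal T_e$ of algebraic multiplicity one, and every other complex eigenvalue $z$ of $\mathcal T_e$ satisfies $|z|<\lambda_2$. 2. For every $r\ge 0$ the limit $I(r)=\lim_{c\to\infty}\mathbb E I_2(A:B)$ exists and does not depend on $m>h$ and $f\ge1$. It decays exponentially in the distance $r$ with correlation length $\xi_{2\mathrm D}$: there are constants $K\neq 0$ and $0<\chi<\xi_{2\mathrm D}$, independent of $r$, $m$ and $f$, such that $$I(r)=K\exp\left(-\frac{r}{\xi_{2\mathrm D}}\right)+O\left[\exp\left(-\frac{r}{\chi}\right)\right]\qquad(r\to\infty).$$ -/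

import Mathlib

noncomputable section

namespace IsoTNS

/-! ### Haar-random gates -/

/-- The unitary group `U (d D²)`. A basis vector of `ℂ^(d D²)` is indexed by a triple
(physical index, horizontal bond index, vertical bond index). -/
abbrev Gate (d D : ℕ) : Type := Matrix.unitaryGroup (Fin d × Fin D × Fin D) ℂ

instance instCompactSpaceGate (d D : ℕ) : CompactSpace (Gate d D) := by
  have hK : IsCompact (Set.pi Set.univ (fun _ : Fin d × Fin D × Fin D =>
      Set.pi Set.univ (fun _ : Fin d × Fin D × Fin D => Metric.closedBall (0 : ℂ) 1))) :=
    isCompact_univ_pi fun _ => isCompact_univ_pi fun _ => isCompact_closedBall _ _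
  have hc : IsClosed (Matrix.unitaryGroup (Fin d × Fin D × Fin D) ℂ :
      Set (Matrix (Fin d × Fin D × Fin D) (Fin d × Fin D × Fin D) ℂ)) := by
    have : (Matrix.unitaryGroup (Fin d × Fin D × Fin D) ℂ :
        Set (Matrix (Fin d × Fin D × Fin D) (Fin d × Fin D × Fin D) ℂ)) =
        {A | A * star A = 1} := by
      ext A
      exact Matrix.mem_unitaryGroup_iff
    rw [this]
    exact isClosed_eq (continuous_id.mul continuous_star) continuous_const
  exact isCompact_iff_compactSpace.mp (IsCompact.of_isClosed_subset hK hc fun U hU i _ j _ => by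
    simpa using entry_norm_bound_of_unitary hU i j)

instance instMeasurableSpaceGate (d D : ℕ) : MeasurableSpace (Gate d D) := borel _

instance instBorelSpaceGate (d D : ℕ) : BorelSpace (Gate d D) := ⟨rfl⟩

/-- The Haar probability measure on `U (d D²)`. -/
def gateHaar (d D : ℕ) : MeasureTheory.Measure (Gate d D) :=
  MeasureTheory.Measure.haarMeasure ⊤

/-! ### The random isoTNS state -/

/-- Sites of a lattice with `m` rows and `n` columns, written (row, column). The orthogonality
center, where the sequential generation starts, is the site in row `0` and column `0`, at the
bottom left. -/
abbrev Site (m n : ℕ) : Type := Fin m × Fin n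

/-- The index on the horizontal leg entering a site, where `R p` is the index on the leg leaving
the site `p` to the right. The legs entering the first column are initialized in `|0⟩`. -/
def leftIn {D m n : ℕ} [NeZero D] (R : Site m n → Fin D) (p : Site m n) : Fin D :=
  if p.2.val = 0 then 0 else R (p.1, ⟨p.2.val - 1, lt_of_le_of_lt (Nat.sub_le _ _) p.2.isLt⟩)

/-- The index on the vertical leg entering a site, where `V p` is the index on the leg leaving
the site `p` upwards. The legs entering the bottom row are initialized in `|0⟩`. -/
def downIn {D m n : ℕ} [NeZero D] (V : Site m n → Fin D) (p : Site m n) : Fin D :=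
  if p.1.val = 0 then 0 else V (⟨p.1.val - 1, lt_of_le_of_lt (Nat.sub_le _ _) p.1.isLt⟩, p.2)

/-- Amplitude of the isoTNS generated by the gates `U`. The site `p` carries the isometry
`|l, b⟩ ↦ U p |0, l, b⟩`, from the bonds entering it from the left and from below to its
physical system, its right bond and its upper bond, and all inner bonds are summed over.
`s` is the configuration of the `d`-dimensional physical systems; `x` and `y` are the
configurations of the ancillas that leave the lattice through its right and its top boundary
and become part of the physical space there. -/
def amplitude {d D m n : ℕ} [NeZero d] [NeZero D] (U : Site m n → Gate d D)
    (s : Site m n → Fin d) (x : Fin m → Fin D) (y : Fin n → Fin D) : ℂ :=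
  ∑ R : Site m n → Fin D, ∑ V : Site m n → Fin D,
    if (∀ p : Site m n, p.2.val + 1 = n → R p = x p.1) ∧
        (∀ p : Site m n, p.1.val + 1 = m → V p = y p.2) then
      ∏ p : Site m n, (U p).val (s p, R p, V p) (0, leftIn R p, downIn V p)
    else 0

/-- The configuration that is `s` on `A` and `t` off `A`. -/
def glue {d m n : ℕ} (A : Finset (Site m n)) (s : {p // p ∈ A} → Fin d)
    (t : {p // p ∉ A} → Fin d) : Site m n → Fin d :=
  fun p => if hp : p ∈ A then s ⟨p, hp⟩ else t ⟨p, hp⟩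

/-- The marginal `ϱ_A = tr_{Aᶜ} |ψ⟩⟨ψ|` on the `d`-dimensional systems of the sites in `A`; all
other sites and the ancillas at the right and at the top boundary are traced out. -/
def reducedState {d D m n : ℕ} [NeZero d] [NeZero D] (U : Site m n → Gate d D)
    (A : Finset (Site m n)) : Matrix ({p // p ∈ A} → Fin d) ({p // p ∈ A} → Fin d) ℂ :=
  Matrix.of fun s s' =>
    ∑ t : {p // p ∉ A} → Fin d, ∑ x : Fin m → Fin D, ∑ y : Fin n → Fin D,
      amplitude U (glue A s t) x y * star (amplitude U (glue A s' t) x y)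

/-- The purity `tr (ϱ_A²)`. -/
def purity {d D m n : ℕ} [NeZero d] [NeZero D] (U : Site m n → Gate d D)
    (A : Finset (Site m n)) : ℝ :=
  (reducedState U A * reducedState U A).trace.re

/-- `𝔼 tr (ϱ_A²)`, all gates being independent and Haar distributed. -/
def expectedPurity (d D m n : ℕ) [NeZero d] [NeZero D] (A : Finset (Site m n)) : ℝ :=
  ∫ U : Site m n → Gate d D, purity U A
    ∂(MeasureTheory.Measure.pi fun _ : Site m n => gateHaar d D)

/-- The annealed average of the Rényi-2 entropy `S₂ (ϱ_A) = - log tr (ϱ_A²)`, in which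
`𝔼 log` is replaced by `log 𝔼`. -/
def annealedRenyiTwo (d D m n : ℕ) [NeZero d] [NeZero D] (A : Finset (Site m n)) : ℝ :=
  - Real.log (expectedPurity d D m n A)

/-- The annealed average of the Rényi-2 mutual information
`I₂ (A : B) = S₂ (ϱ_A) + S₂ (ϱ_B) - S₂ (ϱ_AB)`. -/
def annealedMutualInfo (d D m n : ℕ) [NeZero d] [NeZero D] (A B : Finset (Site m n)) : ℝ :=
  annealedRenyiTwo d D m n A + annealedRenyiTwo d D m n B - annealedRenyiTwo d D m n (A ∪ B)

/-- The block of the `w` consecutive columns starting at column `j` and of the `h` lowest rows.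
It touches the bottom row of the orthogonality hypersurface. -/
def block (m n h j w : ℕ) : Finset (Site m n) :=
  Finset.univ.filter fun p => p.1.val < h ∧ j ≤ p.2.val ∧ p.2.val < j + w

/-! ### Exponential decay -/

/-- `C r = K exp (- r / ξ) + O (exp (- r / χ))` with `ξ > χ > 0`, where `K ≠ 0`, so that `C`
determines the correlation length `ξ`. -/
def DecaysExponentially (C : ℕ → ℝ) (ξ : ℝ) : Prop :=
  ∃ K χ : ℝ, K ≠ 0 ∧ 0 < χ ∧ χ < ξ ∧
    (fun r : ℕ => C r - K * Real.exp (-(r : ℝ) / ξ)) =O[Filter.atTop]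
      (fun r : ℕ => Real.exp (-(r : ℝ) / χ))

/-- `(d D³ - d D) / (d² D⁴ - 1)`. -/
def subleading (d D : ℕ) : ℝ :=
  ((d : ℝ) * (D : ℝ) ^ 3 - (d : ℝ) * (D : ℝ)) / ((d : ℝ) ^ 2 * (D : ℝ) ^ 4 - 1)

/-- The correlation length `ξ_2D`. -/
def xi2D (d D : ℕ) : ℝ := -(Real.log (subleading d D))⁻¹

/-! ### Transfer matrices -/

/-- The number `#(σ)` of cycles of a permutation, fixed points included. -/
def numCycles {k : ℕ} (σ : Equiv.Perm (Fin k)) : ℕ := Multiset.card σ.partition.parts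

/-- The Gram matrix `G_{στ} = q ^ #(σ τ⁻¹)` of the permutation operators on `(ℂ^q)^{⊗ k}`. -/
def gram (k q : ℕ) : Matrix (Equiv.Perm (Fin k)) (Equiv.Perm (Fin k)) ℝ :=
  Matrix.of fun σ τ => (q : ℝ) ^ numCycles (σ * τ⁻¹)

/-- The Weingarten matrix `Wg (σ τ⁻¹, q) = (G⁻¹)_{στ}`, for `k ≤ q`. -/
def weingarten (k q : ℕ) : Matrix (Equiv.Perm (Fin k)) (Equiv.Perm (Fin k)) ℝ := (gram k q)⁻¹

/-- The bulk transfer tensor `T_ρ` of one site, with `τ` on its left and lower legs, `θ` on its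
right leg and `ν` on its upper leg. -/
def siteTensor (d D : ℕ) {k : ℕ} (ρ τ θ ν : Equiv.Perm (Fin k)) : ℝ :=
  ∑ σ : Equiv.Perm (Fin k), weingarten k (d * D ^ 2) σ τ *
    (d : ℝ) ^ numCycles (σ * ρ) * (D : ℝ) ^ numCycles (σ * θ⁻¹) * (D : ℝ) ^ numCycles (σ * ν⁻¹)

/-- The transfer matrix `𝒯_ρ` of a column of `h` sites: the contraction of `h` bulk tensors `T_ρ`
along their vertical legs. The lower and left legs of a site carry the same permutation, so that
the upper leg of a site carries the left index of the next one; the upper leg of the last site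
carries the trivial permutation, and the lower leg of the first one is summed over. -/
def columnTransfer (d D k h : ℕ) (ρ : Equiv.Perm (Fin k)) :
    Matrix (Fin h → Equiv.Perm (Fin k)) (Fin h → Equiv.Perm (Fin k)) ℝ :=
  Matrix.of fun τ θ => ∏ i : Fin h,
    siteTensor d D ρ (τ i) (θ i) (if hi : i.val + 1 < h then τ ⟨i.val + 1, hi⟩ else 1)

end IsoTNS

end

noncomputable section

namespace IsoTNS

section

open MeasureTheory

/-! ### Second moments of a Haar random gate -/

/-! The Haar average of the purity turns two copies of ket and bra into a spin model with one `S₂`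
spin `τ` per site (`moment_eq_weingarten`, `expectedPurity_eq`). The weights are `siteTensor`, with
physical permutation `sw` inside the subsystem and `1` outside. The decisive entry is a zero: if the
physical system and both outgoing legs carry `ρ`, then the site carries `ρ` with weight 1
(`siteTensor_eq`). Hence rows above height `h` and columns to the right of the last block freeze to
`1`, and the purity is a product of powers of the height-`h` transfer matrices `T` (physical
permutation `1`) and `S` (physical permutation `sw`).

The same zero makes `T` block triangular in its top spin. Its diagonal blocks are the transfer
matrix of height `h - 1` and `λ₂` times a column of height `h - 1` with `sw` above it. If that
column is nonempty, its column sums are at most `contraction d D < 1`, so the second block has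
spectral radius below `λ₂`; at height 1 it is the scalar `λ₂`. Induction on the height gives the
spectrum (`charpoly_columnTransfer_succ`, `norm_root_charpoly_column_sw_lt`). The same induction,
run on perturbed trajectories, gives `T ^ r u = a vac + b λ₂ ^ r subVec + O(χ ^ r)` without any
Jordan form (`exists_isBigO_trajectory`).

As `c → ∞`, the columns on the left converge to a stationary row vector `ℓ`. With `G = ℓ S ^ a` and
`u = S ^ b vac`, the purities tend to `G ⬝ vac` for `A`, `ℓ ⬝ u` for `B` and `G T ^ r u` for the
union. The leading coefficient of `u` is `ℓ ⬝ u`, so the ratio of the joint purity to the product is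
`1 + K λ₂ ^ r + O(χ ^ r)`, and taking logarithms gives the decay.

It remains to show `K ≠ 0`. The `subVec` coefficient of `u` is positive because `u` is entrywise
positive and `λ₂` is a diagonal entry of the nonnegative matrix `T` (`coeff_pos`). The other factor
`G ⬝ subVec` needs more, since `subVec` has entries of both signs: the row vectors lie in a cone
`IsTame`, preserved by `T` and `S`, on which the pairing with `S subVec` is positive
(`IsTame.vecMul`, `IsTame.dotProduct_pos`). -/

instance instIsMulLeftInvariantGateHaar (d D : ℕ) : (gateHaar d D).IsMulLeftInvariant := by
  unfold gateHaar; infer_instance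

instance instIsProbabilityMeasureGateHaar (d D : ℕ) : IsProbabilityMeasure (gateHaar d D) :=
  ⟨by simpa [gateHaar] using
    Measure.haarMeasure_self (K₀ := (⊤ : TopologicalSpace.PositiveCompacts (Gate d D)))⟩

/-- The index set of a basis of `ℂ ^ (d D²)`. -/
abbrev GateIndex (d D : ℕ) : Type := Fin d × Fin D × Fin D

/-- The integrand of a second moment. -/
def momentFun {d D : ℕ} (i₁ i₂ k₁ k₂ j₁ j₂ l₁ l₂ : GateIndex d D) (U : Gate d D) : ℂ :=
  U.val i₁ j₁ * U.val i₂ j₂ * star (U.val k₁ l₁) * star (U.val k₂ l₂)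

/-- The second moment `𝔼 U_{i₁ j₁} U_{i₂ j₂} conj U_{k₁ l₁} conj U_{k₂ l₂}`. -/
def moment {d D : ℕ} (i₁ i₂ k₁ k₂ j₁ j₂ l₁ l₂ : GateIndex d D) : ℂ :=
  ∫ U, momentFun i₁ i₂ k₁ k₂ j₁ j₂ l₁ l₂ U ∂gateHaar d D

lemma continuous_entry {d D : ℕ} (i j : GateIndex d D) :
    Continuous fun U : Gate d D => U.val i j :=
  (continuous_apply_apply i j).comp continuous_subtype_val

lemma integrable_of_continuous {d D : ℕ} {f : Gate d D → ℂ} (hf : Continuous f) :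
    Integrable f (gateHaar d D) :=
  hf.integrable_of_hasCompactSupport (HasCompactSupport.of_compactSpace f)

lemma continuous_momentFun {d D : ℕ} (i₁ i₂ k₁ k₂ j₁ j₂ l₁ l₂ : GateIndex d D) :
    Continuous (momentFun i₁ i₂ k₁ k₂ j₁ j₂ l₁ l₂) := by
  unfold momentFun
  exact (((continuous_entry _ _).mul (continuous_entry _ _)).mul (continuous_entry _ _).star).mul
    (continuous_entry _ _).star

lemma integrable_momentFun {d D : ℕ} (i₁ i₂ k₁ k₂ j₁ j₂ l₁ l₂ : GateIndex d D) :
    Integrable (momentFun i₁ i₂ k₁ k₂ j₁ j₂ l₁ l₂) (gateHaar d D) :=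
  integrable_of_continuous (continuous_momentFun _ _ _ _ _ _ _ _)

/-! ### Consequences of left invariance -/

section Invariance

variable {d D : ℕ} (i₁ i₂ k₁ k₂ j₁ j₂ l₁ l₂ : GateIndex d D)

lemma moment_eq_integral_mul (V : Gate d D) :
    moment i₁ i₂ k₁ k₂ j₁ j₂ l₁ l₂ =
      ∫ U, momentFun i₁ i₂ k₁ k₂ j₁ j₂ l₁ l₂ (V * U) ∂gateHaar d D :=
  (integral_mul_left_eq_self _ V).symm

lemma moment_perm (σ : Equiv.Perm (GateIndex d D)) :
    moment (σ i₁) (σ i₂) (σ k₁) (σ k₂) j₁ j₂ l₁ l₂ = moment i₁ i₂ k₁ k₂ j₁ j₂ l₁ l₂ := by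
  have hV : (1 : Matrix (GateIndex d D) (GateIndex d D) ℂ).submatrix σ id ∈
      Matrix.unitaryGroup (GateIndex d D) ℂ := by
    rw [Matrix.mem_unitaryGroup_iff]
    ext a b
    simp [Matrix.mul_apply, Matrix.one_apply, Matrix.star_apply, apply_ite]
  rw [moment_eq_integral_mul i₁ i₂ k₁ k₂ j₁ j₂ l₁ l₂ ⟨_, hV⟩]
  unfold moment momentFun
  simp [Matrix.mul_apply, Matrix.one_apply]

lemma moment_phase (c : GateIndex d D → ℂ) (hc : ∀ i, c i * star (c i) = 1) :
    moment i₁ i₂ k₁ k₂ j₁ j₂ l₁ l₂ =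
      c i₁ * c i₂ * star (c k₁) * star (c k₂) * moment i₁ i₂ k₁ k₂ j₁ j₂ l₁ l₂ := by
  have hV : Matrix.diagonal c ∈ Matrix.unitaryGroup (GateIndex d D) ℂ := by
    rw [Matrix.mem_unitaryGroup_iff, Matrix.star_eq_conjTranspose, Matrix.diagonal_conjTranspose,
      Matrix.diagonal_mul_diagonal, ← Matrix.diagonal_one]
    congr 1
    ext i
    exact hc i
  conv_lhs => rw [moment_eq_integral_mul i₁ i₂ k₁ k₂ j₁ j₂ l₁ l₂ ⟨_, hV⟩]
  unfold moment
  rw [← integral_const_mul]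
  congr 1
  ext U
  simp only [momentFun, Submonoid.coe_mul, Matrix.diagonal_mul, star_mul']
  ring

variable {i₁ i₂ k₁ k₂}

/-- Multiplying a single row by the phase `I` rescales the moment by a power of `I`. When the row
pairs of ket and bra differ as multisets, some row can be chosen for which this power is not 1: the
unmatched ket row if one bra row matches, otherwise `k₁`. -/
lemma moment_eq_zero (h : ¬ (k₁ = i₁ ∧ k₂ = i₂)) (h' : ¬ (k₁ = i₂ ∧ k₂ = i₁)) :
    moment i₁ i₂ k₁ k₂ j₁ j₂ l₁ l₂ = 0 := by
  have key := fun a => moment_phase i₁ i₂ k₁ k₂ j₁ j₂ l₁ l₂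
    (fun i => if i = a then Complex.I else 1) (fun i => by split_ifs <;> simp)
  have aux : ∀ z : ℂ, ∀ w : ℂ, w ≠ 1 → z = w * z → z = 0 := by
    intro z w hw hz
    have : (w - 1) * z = 0 := by linear_combination -hz
    exact (mul_eq_zero.mp this).resolve_left (sub_ne_zero.mpr hw)
  have hI : Complex.I ≠ 1 := fun h => by simpa using congrArg Complex.re h
  by_cases h1 : k₁ = i₁
  · have h2 : k₂ ≠ i₂ := fun e => h ⟨h1, e⟩
    refine aux _ _ ?_ (key i₂)
    by_cases h3 : i₁ = i₂ <;> simp [h1, h2, h3, hI]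
  · by_cases h1' : k₁ = i₂
    · have h2 : k₂ ≠ i₁ := fun e => h' ⟨h1', e⟩
      refine aux _ _ ?_ (key i₁)
      by_cases h3 : i₂ = i₁ <;> simp [h1', h2, h3, hI]
    · refine aux _ _ ?_ (key k₁)
      rw [if_neg (Ne.symm h1), if_neg (Ne.symm h1'), if_pos rfl]
      split_ifs
      · simp only [mul_one, one_mul, Complex.star_def, Complex.conj_I, neg_mul_neg, Complex.I_mul_I]
        norm_num
      · simp only [mul_one, one_mul, Complex.star_def, Complex.conj_I, star_one]
        exact fun h => by simpa using congrArg Complex.re h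

/-- Permutations and phases cannot relate coinciding rows to distinct ones, so a genuine rotation is
needed. Invariance under `(1 + I P) / √2`, with `P` the transposition of `k` and `l`, expands the
moment into 16 terms. Phases leave six of them, which permutation invariance groups in pairs: `M =
(2 M + 2 A + 2 B) / 4`. -/
lemma moment_half {k l : GateIndex d D} (hkl : k ≠ l) :
    moment k k k k j₁ j₂ l₁ l₂ =
      moment k l k l j₁ j₂ l₁ l₂ + moment k l l k j₁ j₂ l₁ l₂ := by
  set σ : Equiv.Perm (GateIndex d D) := Equiv.swap k l with hσ
  set c : ℂ := (((Real.sqrt 2)⁻¹ : ℝ) : ℂ) with hc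
  have hcc : c * c = 1 / 2 := by
    rw [hc, ← Complex.ofReal_mul, ← mul_inv, Real.mul_self_sqrt (by norm_num)]
    norm_num
  have hcs : star c = c := by simp [hc]
  set P : Matrix (GateIndex d D) (GateIndex d D) ℂ :=
    (1 : Matrix (GateIndex d D) (GateIndex d D) ℂ).submatrix σ id with hP
  have hPP : P * P = 1 := by
    ext a b
    rw [Matrix.mul_apply, Finset.sum_eq_single (σ a)]
    · simp [hP, hσ, Matrix.one_apply]
    · intro j _ hj
      simp [hP, Matrix.one_apply, Ne.symm hj]
    · simp
  have hPs : star P = P := by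
    ext a b
    simp only [hP, hσ, Matrix.star_apply, Matrix.submatrix_apply, Matrix.one_apply, id, apply_ite star,
      star_one, star_zero]
    congr 1
    rw [eq_iff_iff, Equiv.swap_apply_eq_iff, eq_comm]
  have hV : c • (1 + Complex.I • P) ∈ Matrix.unitaryGroup (GateIndex d D) ℂ := by
    rw [Matrix.mem_unitaryGroup_iff, star_smul, star_add, star_smul, star_one, hPs, hcs,
      smul_mul_smul_comm, hcc]
    have : (1 + Complex.I • P) * (1 + star Complex.I • P) = (2 : ℂ) • 1 := by
      rw [add_mul, mul_add, mul_add, smul_mul_smul_comm, hPP, one_mul, one_mul, mul_one]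
      simp
      rw [two_smul]
    rw [this, smul_smul]
    norm_num
  have hrow : ∀ U : Gate d D, ∀ j, ((⟨_, hV⟩ * U : Gate d D)).val k j =
      c * (U.val k j + Complex.I * U.val l j) := by
    intro U j
    simp [hP, hσ, add_mul, Matrix.mul_apply, Matrix.one_apply, Finset.sum_add_distrib]
    ring
  have hsI : star Complex.I = - Complex.I := Complex.conj_I
  have e1 := moment_eq_integral_mul k k k k j₁ j₂ l₁ l₂ ⟨_, hV⟩
  have e2 : ∀ U : Gate d D, momentFun k k k k j₁ j₂ l₁ l₂ (⟨_, hV⟩ * U) =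
      (1 / 4) * ∑ x : Fin 2 × Fin 2 × Fin 2 × Fin 2,
        ((if x.1 = 0 then 1 else Complex.I) * (if x.2.1 = 0 then 1 else Complex.I) *
        (if x.2.2.1 = 0 then 1 else - Complex.I) * (if x.2.2.2 = 0 then 1 else - Complex.I)) *
        momentFun (if x.1 = 0 then k else l) (if x.2.1 = 0 then k else l)
          (if x.2.2.1 = 0 then k else l) (if x.2.2.2 = 0 then k else l) j₁ j₂ l₁ l₂ U := by
    intro U
    have h4 : c * c * c * c = 1 / 4 := by
      linear_combination (c * c + 1 / 2) * hcc
    simp only [momentFun, hrow, Fintype.sum_prod_type, Fin.sum_univ_two, star_mul', hcs, star_add, hsI, if_true, one_ne_zero, if_false]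
    linear_combination ((U.val k j₁ + Complex.I * U.val l j₁) *
      (U.val k j₂ + Complex.I * U.val l j₂) *
      (star (U.val k l₁) - Complex.I * star (U.val l l₁)) *
      (star (U.val k l₂) - Complex.I * star (U.val l l₂))) * h4
  simp_rw [e2] at e1
  rw [integral_const_mul, integral_finsetSum _ fun x _ =>
    (integrable_momentFun _ _ _ _ _ _ _ _).const_mul _] at e1
  simp_rw [integral_const_mul] at e1
  change _ = (1 / 4) * ∑ x : Fin 2 × Fin 2 × Fin 2 × Fin 2,
        ((if x.1 = 0 then 1 else Complex.I) * (if x.2.1 = 0 then 1 else Complex.I) *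
        (if x.2.2.1 = 0 then 1 else - Complex.I) * (if x.2.2.2 = 0 then 1 else - Complex.I)) *
        moment (if x.1 = 0 then k else l) (if x.2.1 = 0 then k else l)
          (if x.2.2.1 = 0 then k else l) (if x.2.2.2 = 0 then k else l) j₁ j₂ l₁ l₂ at e1
  simp only [Fintype.sum_prod_type, Fin.sum_univ_two] at e1
  have z : ∀ a b a' b', ¬ (a' = a ∧ b' = b) → ¬ (a' = b ∧ b' = a) →
    moment a b a' b' j₁ j₂ l₁ l₂ = 0 := fun a b a' b' => moment_eq_zero j₁ j₂ l₁ l₂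
  have s1 : moment l l l l j₁ j₂ l₁ l₂ = moment k k k k j₁ j₂ l₁ l₂ := by
    have := moment_perm k k k k j₁ j₂ l₁ l₂ σ
    simpa [hσ] using this
  have s2 : moment l k l k j₁ j₂ l₁ l₂ = moment k l k l j₁ j₂ l₁ l₂ := by
    have := moment_perm k l k l j₁ j₂ l₁ l₂ σ
    simpa [hσ] using this
  have s3 : moment l k k l j₁ j₂ l₁ l₂ = moment k l l k j₁ j₂ l₁ l₂ := by
    have := moment_perm k l l k j₁ j₂ l₁ l₂ σ
    simpa [hσ] using this
  simp [z, hkl, hkl.symm, s1, s2, s3] at e1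
  linear_combination 2 * e1

end Invariance

lemma exists_perm_pair {α : Type*} [DecidableEq α] {a b x y : α} (hab : a ≠ b) (hxy : x ≠ y) :
    ∃ σ : Equiv.Perm α, σ a = x ∧ σ b = y := by
  refine ⟨(Equiv.swap (Equiv.swap a x b) y) * Equiv.swap a x, ?_, ?_⟩
  · rw [Equiv.Perm.mul_apply, Equiv.swap_apply_left]
    refine Equiv.swap_apply_of_ne_of_ne ?_ hxy
    intro h
    apply hab
    exact (Equiv.swap a x).injective ((Equiv.swap_apply_left a x).trans h)
  · rw [Equiv.Perm.mul_apply, Equiv.swap_apply_left]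

/-- Permutations act doubly transitively on the rows, so for fixed columns two values at one pair of
distinct rows determine all moments; coinciding rows follow from `moment_half`. -/
lemma exists_moment_eq {d D : ℕ} (j₁ j₂ l₁ l₂ : GateIndex d D)
    (hcard : 2 ≤ Fintype.card (GateIndex d D)) :
    ∃ f g : ℂ, ∀ i₁ i₂ k₁ k₂ : GateIndex d D, moment i₁ i₂ k₁ k₂ j₁ j₂ l₁ l₂ =
      f * (if k₁ = i₁ ∧ k₂ = i₂ then 1 else 0) + g * (if k₁ = i₂ ∧ k₂ = i₁ then 1 else 0) := by
  obtain ⟨a, b, hab⟩ := Fintype.exists_pair_of_one_lt_card hcard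
  refine ⟨moment a b a b j₁ j₂ l₁ l₂, moment a b b a j₁ j₂ l₁ l₂, fun i₁ i₂ k₁ k₂ => ?_⟩
  by_cases h : i₁ = i₂
  · subst h
    by_cases hk : k₁ = i₁ ∧ k₂ = i₁
    · obtain ⟨rfl, rfl⟩ := hk
      have : ∃ l, k₂ ≠ l := by
        by_cases h : k₂ = a
        · exact ⟨b, h ▸ hab⟩
        · exact ⟨a, h⟩
      obtain ⟨l, hl⟩ := this
      obtain ⟨σ, rfl, rfl⟩ := exists_perm_pair hab hl
      rw [moment_half _ _ _ _ hl, moment_perm, moment_perm]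
      simp
    · rw [moment_eq_zero _ _ _ _ hk hk]
      simp [hk]
  · obtain ⟨σ, rfl, rfl⟩ := exists_perm_pair hab h
    by_cases hk : k₁ = σ a ∧ k₂ = σ b
    · obtain ⟨rfl, rfl⟩ := hk
      rw [moment_perm]
      simp [hab, hab.symm]
    · by_cases hk' : k₁ = σ b ∧ k₂ = σ a
      · obtain ⟨rfl, rfl⟩ := hk'
        rw [moment_perm]
        simp [hab, hab.symm]
      · rw [moment_eq_zero _ _ _ _ hk hk']
        simp [hk, hk']

lemma sum_entry_mul_star {d D : ℕ} (U : Gate d D) (j l : GateIndex d D) :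
    ∑ i, U.val i j * star (U.val i l) = if l = j then 1 else 0 := by
  have h := congrFun (congrFun (Matrix.mem_unitaryGroup_iff'.mp U.2) l) j
  rw [Matrix.mul_apply, Matrix.one_apply] at h
  rw [← h]
  exact Finset.sum_congr rfl fun i _ => by rw [Matrix.star_apply, mul_comm]

lemma sum_moment_diag {d D : ℕ} (j₁ j₂ l₁ l₂ : GateIndex d D) :
    ∑ i₁, ∑ i₂, moment i₁ i₂ i₁ i₂ j₁ j₂ l₁ l₂ = if l₁ = j₁ ∧ l₂ = j₂ then 1 else 0 := by
  have : ∀ U : Gate d D, ∑ i₁, ∑ i₂, momentFun i₁ i₂ i₁ i₂ j₁ j₂ l₁ l₂ U =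
      if l₁ = j₁ ∧ l₂ = j₂ then 1 else 0 := by
    intro U
    have : ∑ i₁, ∑ i₂, momentFun i₁ i₂ i₁ i₂ j₁ j₂ l₁ l₂ U =
      (∑ i₁, U.val i₁ j₁ * star (U.val i₁ l₁)) * ∑ i₂, U.val i₂ j₂ * star (U.val i₂ l₂) := by
      rw [Finset.sum_mul_sum]
      refine Finset.sum_congr rfl fun _ _ => Finset.sum_congr rfl fun _ _ => ?_
      unfold momentFun; ring
    rw [this, sum_entry_mul_star, sum_entry_mul_star]
    split_ifs <;> simp_all
  unfold moment
  simp_rw [← integral_finsetSum Finset.univ fun _ _ => integrable_momentFun _ _ _ _ j₁ j₂ l₁ l₂]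
  rw [← integral_finsetSum Finset.univ fun _ _ => integrable_finsetSum _ fun _ _ =>
    integrable_momentFun _ _ _ _ j₁ j₂ l₁ l₂]
  simp_rw [this]
  simp

/-- Exchanging the two conjugated factors reduces this to `sum_moment_diag`. -/
lemma sum_moment_cross {d D : ℕ} (j₁ j₂ l₁ l₂ : GateIndex d D) :
    ∑ i₁, ∑ i₂, moment i₁ i₂ i₂ i₁ j₁ j₂ l₁ l₂ = if l₁ = j₂ ∧ l₂ = j₁ then 1 else 0 := by
  have h := sum_moment_diag j₁ j₂ l₂ l₁
  simp only [and_comm (a := l₂ = j₁)] at h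
  rw [← h]
  refine Finset.sum_congr rfl fun _ _ => Finset.sum_congr rfl fun _ _ => ?_
  unfold moment momentFun
  congr 1
  ext U
  ring

/-! ### The symmetric group on two letters -/

/-- The nontrivial element of `S₂`. -/
abbrev sw : Equiv.Perm (Fin 2) := Equiv.swap 0 1

lemma perm_two_cases (σ : Equiv.Perm (Fin 2)) : σ = 1 ∨ σ = sw := by
  revert σ; decide

@[simp] lemma sw_ne_one : sw ≠ 1 := by decide

@[simp] lemma one_ne_sw : (1 : Equiv.Perm (Fin 2)) ≠ sw := by decide

@[simp] lemma sw_inv : sw⁻¹ = sw := by decide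

lemma sum_perm_two {M : Type*} [AddCommMonoid M] (f : Equiv.Perm (Fin 2) → M) :
    ∑ σ, f σ = f 1 + f sw := by
  have : (Finset.univ : Finset (Equiv.Perm (Fin 2))) = {1, sw} := by decide
  rw [this, Finset.sum_pair one_ne_sw]

@[simp] lemma numCycles_one : numCycles (1 : Equiv.Perm (Fin 2)) = 2 := by
  simp [numCycles, Equiv.Perm.parts_partition]

@[simp] lemma numCycles_sw : numCycles sw = 1 := by
  have h : sw.IsCycle := Equiv.Perm.isCycle_swap (by decide)
  simp [numCycles, Equiv.Perm.parts_partition, h.cycleType]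

lemma weingarten_two (q : ℕ) (hq : 2 ≤ q) (σ τ : Equiv.Perm (Fin 2)) :
    weingarten 2 q σ τ =
      if σ = τ then 1 / ((q : ℝ) ^ 2 - 1) else - 1 / ((q : ℝ) * ((q : ℝ) ^ 2 - 1)) := by
  have hq' : (2 : ℝ) ≤ q := by exact_mod_cast hq
  have h0 : (q : ℝ) ≠ 0 := by positivity
  have h1 : (q : ℝ) ^ 2 - 1 ≠ 0 := by nlinarith
  have key : weingarten 2 q = Matrix.of fun σ τ : Equiv.Perm (Fin 2) =>
      if σ = τ then 1 / ((q : ℝ) ^ 2 - 1) else - 1 / ((q : ℝ) * ((q : ℝ) ^ 2 - 1)) := by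
    refine Matrix.inv_eq_right_inv ?_
    ext a b
    rw [Matrix.mul_apply, sum_perm_two]
    rcases perm_two_cases a with rfl | rfl <;> rcases perm_two_cases b with rfl | rfl <;>
      simp [gram] <;> field_simp <;> ring
  rw [key]
  rfl

/-- Two pairs agree up to the permutation `σ`. -/
def pairDelta {α : Type*} [DecidableEq α] (σ : Equiv.Perm (Fin 2)) (x₁ x₂ y₁ y₂ : α) : ℝ :=
  if σ = 1 then (if y₁ = x₁ ∧ y₂ = x₂ then 1 else 0) else (if y₁ = x₂ ∧ y₂ = x₁ then 1 else 0)

/-- Left invariance fixes the dependence on the rows up to two coefficients. Unitarity of the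
columns, contracted in the two possible ways, yields a linear system for them whose matrix is the
Gram matrix; its inverse is the Weingarten matrix. Right invariance is not needed. -/
theorem moment_eq_weingarten {d D : ℕ} (hd : 2 ≤ d) (hD : 2 ≤ D)
    (i₁ i₂ k₁ k₂ j₁ j₂ l₁ l₂ : GateIndex d D) :
    moment i₁ i₂ k₁ k₂ j₁ j₂ l₁ l₂ =
      ((∑ σ : Equiv.Perm (Fin 2), ∑ τ : Equiv.Perm (Fin 2), weingarten 2 (d * D ^ 2) σ τ *
        (pairDelta σ i₁ i₂ k₁ k₂ * pairDelta τ j₁ j₂ l₁ l₂) : ℝ) : ℂ) := by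
  have hcard : Fintype.card (GateIndex d D) = d * D ^ 2 := by simp [sq]
  have hq : 2 ≤ d * D ^ 2 := by nlinarith [Nat.pow_le_pow_left hD 2]
  obtain ⟨f, g, hfg⟩ := exists_moment_eq j₁ j₂ l₁ l₂ (hcard ▸ hq)
  have h1 := sum_moment_diag j₁ j₂ l₁ l₂
  have h2 := sum_moment_cross j₁ j₂ l₁ l₂
  simp_rw [hfg] at h1 h2
  have hsym : ∀ i₁ i₂ : GateIndex d D, (i₁ = i₂ ∧ i₂ = i₁) ↔ i₁ = i₂ :=
    fun _ _ => ⟨fun h => h.1, fun h => ⟨h, h.symm⟩⟩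
  simp only [Finset.sum_add_distrib, ← Finset.mul_sum, hsym, and_self, if_true,
    Finset.sum_const, Finset.card_univ, hcard, Finset.sum_ite_eq, Finset.sum_ite_eq', Finset.mem_univ,
    nsmul_eq_mul, mul_one] at h1 h2
  rw [hfg]
  generalize d * D ^ 2 = q at *
  have hq' : (2 : ℝ) ≤ q := by exact_mod_cast hq
  have h0 : (q : ℂ) ≠ 0 := by exact_mod_cast (by positivity : (q : ℝ) ≠ 0)
  have h3 : (q : ℂ) ^ 2 - 1 ≠ 0 := by exact_mod_cast (by nlinarith : (q : ℝ) ^ 2 - 1 ≠ 0)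
  -- The system is `q² f + q g = δ`, `q f + q² g = δ'`, with `δ` and `δ'` the direct and crossed
  -- column deltas.
  have hf : f = ((if l₁ = j₁ ∧ l₂ = j₂ then 1 else 0) -
      (if l₁ = j₂ ∧ l₂ = j₁ then 1 else 0) / q) / ((q : ℂ) ^ 2 - 1) := by
    rw [← h1, ← h2]; field_simp; ring
  have hg : g = ((if l₁ = j₂ ∧ l₂ = j₁ then 1 else 0) -
      (if l₁ = j₁ ∧ l₂ = j₂ then 1 else 0) / q) / ((q : ℂ) ^ 2 - 1) := by
    rw [← h1, ← h2]; field_simp; ring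
  rw [hf, hg]
  simp only [sum_perm_two, weingarten_two q hq, pairDelta, if_true, one_ne_sw, sw_ne_one, if_false]
  split_ifs <;> push_cast <;> field_simp <;> ring

end

section

open MeasureTheory

/-! ### Averaging over the gates -/

section Bonds

variable {P : Type*} [Fintype P] [DecidableEq P]

lemma sum_pi_prod {α R : Type*} [Fintype α] [CommSemiring R] (G : P → α → R) :
    ∑ f : P → α, ∏ p, G p (f p) = ∏ p, ∑ x, G p x := by
  rw [Finset.prod_univ_sum, Fintype.piFinset_univ]

lemma pairDelta_prod {α β : Type*} [DecidableEq α] [DecidableEq β] (σ : Equiv.Perm (Fin 2))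
    (x₁ x₂ y₁ y₂ : α) (u₁ u₂ v₁ v₂ : β) :
    pairDelta σ (x₁, u₁) (x₂, u₂) (y₁, v₁) (y₂, v₂) =
      pairDelta σ x₁ x₂ y₁ y₂ * pairDelta σ u₁ u₂ v₁ v₂ := by
  unfold pairDelta
  simp only [Prod.mk.injEq]
  by_cases h : σ = 1
  · simp only [h, if_true, mul_ite, mul_one, mul_zero]
    split_ifs <;> simp_all
  · simp only [h, if_false, mul_ite, mul_one, mul_zero]
    split_ifs <;> simp_all

lemma pairDelta_self {α : Type*} [DecidableEq α] (σ : Equiv.Perm (Fin 2)) (x : α) :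
    pairDelta σ x x x x = 1 := by
  simp [pairDelta]

/-- This is the trace of a product of two permutation operators: each closed index loop, that is
each cycle of `σ τ⁻¹`, contributes one free index. -/
lemma sum_pairDelta_mul {α : Type*} [Fintype α] [DecidableEq α] (σ τ : Equiv.Perm (Fin 2)) :
    ∑ x₁ : α, ∑ y₁ : α, ∑ x₂ : α, ∑ y₂ : α, pairDelta σ x₁ x₂ y₁ y₂ * pairDelta τ x₁ x₂ y₁ y₂ =
      (Fintype.card α : ℝ) ^ numCycles (σ * τ⁻¹) := by
  have h1 : ∀ x₁ x₂ : α, ∀ ρ : Equiv.Perm (Fin 2), ∑ y₁ : α, ∑ y₂ : α,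
      pairDelta 1 x₁ x₂ y₁ y₂ * pairDelta ρ x₁ x₂ y₁ y₂ = pairDelta ρ x₁ x₂ x₁ x₂ := by
    intro x₁ x₂ ρ
    rw [Finset.sum_eq_single x₁, Finset.sum_eq_single x₂]
    · simp [pairDelta]
    · intro b _ hb; simp [pairDelta, hb]
    · simp
    · intro b _ hb; simp [pairDelta, hb]
    · simp
  have h2 : ∀ x₁ x₂ : α, ∀ ρ : Equiv.Perm (Fin 2), ∑ y₁ : α, ∑ y₂ : α,
      pairDelta sw x₁ x₂ y₁ y₂ * pairDelta ρ x₁ x₂ y₁ y₂ = pairDelta ρ x₁ x₂ x₂ x₁ := by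
    intro x₁ x₂ ρ
    rw [Finset.sum_eq_single x₂, Finset.sum_eq_single x₁]
    · simp [pairDelta]
    · intro b _ hb; simp [pairDelta, hb]
    · simp
    · intro b _ hb; simp [pairDelta, hb]
    · simp
  have h3 : ∀ x₁ x₂ : α, (x₁ = x₂ ∧ x₂ = x₁) ↔ x₁ = x₂ :=
    fun _ _ => ⟨fun h => h.1, fun h => ⟨h, h.symm⟩⟩
  have h3' : ∀ x₁ x₂ : α, (x₂ = x₁ ∧ x₁ = x₂) ↔ x₁ = x₂ :=
    fun _ _ => ⟨fun h => h.2, fun h => ⟨h.symm, h⟩⟩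
  have comm : ∀ F : α → α → α → α → ℝ, ∑ x₁ : α, ∑ y₁ : α, ∑ x₂ : α, ∑ y₂ : α, F x₁ y₁ x₂ y₂ =
      ∑ x₁ : α, ∑ x₂ : α, ∑ y₁ : α, ∑ y₂ : α, F x₁ y₁ x₂ y₂ :=
    fun F => Finset.sum_congr rfl fun _ _ => Finset.sum_comm
  rw [comm]
  rcases perm_two_cases σ with rfl | rfl
  · simp_rw [h1]
    rcases perm_two_cases τ with rfl | rfl
    · simp [pairDelta, sq]
    · simp [pairDelta, h3]
  · simp_rw [h2]
    rcases perm_two_cases τ with rfl | rfl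
    · simp [pairDelta, h3']
    · simp [pairDelta, sq]

/-- The index on the leg entering a site from its predecessor, if there is one. -/
def legIn {D : ℕ} [NeZero D] (pred : P → Option P) (R : P → Fin D) (p : P) : Fin D :=
  (pred p).elim 0 R

/-- The indicator of agreement of ket and bra on the legs leaving the lattice. -/
def bdry {D : ℕ} (succ : P → Option P) (R R' : P → Fin D) : ℝ :=
  if ∀ p, succ p = none → R p = R' p then 1 else 0

-- Tracing out a leg that leaves the lattice joins each ket to its own bra, so the exterior acts as
-- a site with permutation `1`.
omit [DecidableEq P] in
lemma bdry_mul_bdry {D : ℕ} (succ : P → Option P) (R₁ R₁' R₂ R₂' : P → Fin D) :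
    bdry succ R₁ R₁' * bdry succ R₂ R₂' =
      ∏ p, if succ p = none then pairDelta 1 (R₁ p) (R₂ p) (R₁' p) (R₂' p) else 1 := by
  by_cases h : (∀ p, succ p = none → R₁ p = R₁' p) ∧ (∀ p, succ p = none → R₂ p = R₂' p)
  · rw [bdry, bdry, if_pos h.1, if_pos h.2, one_mul, Finset.prod_eq_one]
    intro p _
    split_ifs with hp
    · simp [pairDelta, h.1 p hp, h.2 p hp]
    · rfl
  · have : bdry succ R₁ R₁' * bdry succ R₂ R₂' = 0 := by
      by_cases h1 : (∀ p, succ p = none → R₁ p = R₁' p)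
      · rw [bdry, bdry, if_neg (fun h2 => h ⟨h1, h2⟩), mul_zero]
      · rw [bdry, if_neg h1, zero_mul]
    rw [this]
    have h' : ∃ p, succ p = none ∧ ¬ (R₁ p = R₁' p ∧ R₂ p = R₂' p) := by
      by_contra! hc
      exact h ⟨fun p hp => (hc p hp).1, fun p hp => (hc p hp).2⟩
    obtain ⟨p, hp, hne⟩ := h'
    refine (Finset.prod_eq_zero (Finset.mem_univ p) ?_).symm
    rw [if_pos hp, pairDelta, if_pos rfl, if_neg]
    exact fun hc => hne ⟨hc.1.symm, hc.2.symm⟩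

/-- Each inner bond is seen once as an incoming and once as an outgoing leg, so the product over
incoming legs can be reindexed by outgoing ones. Incoming boundary legs all carry the index 0 and
contribute 1; outgoing boundary legs take their factor from `bdry`. -/
lemma prod_legIn {D : ℕ} [NeZero D] {pred succ : P → Option P}
    (h : ∀ p q, pred p = some q ↔ succ q = some p) (τ : P → Equiv.Perm (Fin 2))
    (R₁ R₁' R₂ R₂' : P → Fin D) :
    bdry succ R₁ R₁' * bdry succ R₂ R₂' * ∏ p, pairDelta (τ p) (legIn pred R₁ p)
        (legIn pred R₂ p) (legIn pred R₁' p) (legIn pred R₂' p) =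
      ∏ p, pairDelta ((succ p).elim 1 τ) (R₁ p) (R₂ p) (R₁' p) (R₂' p) := by
  have h1 : ∀ p, pairDelta (τ p) (legIn pred R₁ p) (legIn pred R₂ p) (legIn pred R₁' p)
      (legIn pred R₂' p) =
      ∏ q, if succ q = some p then pairDelta (τ p) (R₁ q) (R₂ q) (R₁' q) (R₂' q) else 1 := by
    intro p
    simp_rw [← h]
    rcases hp : pred p with _ | q
    · simp [legIn, hp, pairDelta_self]
    · simp [legIn, hp]
  simp_rw [h1]
  rw [Finset.prod_comm, bdry_mul_bdry, ← Finset.prod_mul_distrib]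
  refine Finset.prod_congr rfl fun q _ => ?_
  rcases hq : succ q with _ | p
  · simp
  · simp

lemma sum_bonds {D : ℕ} [NeZero D] {pred succ : P → Option P}
    (h : ∀ p q, pred p = some q ↔ succ q = some p) (σ τ : P → Equiv.Perm (Fin 2)) :
    ∑ w₁ : (P → Fin D) × (P → Fin D), ∑ w₂ : (P → Fin D) × (P → Fin D),
      (bdry succ w₁.1 w₁.2 * bdry succ w₂.1 w₂.2 *
        ((∏ p, pairDelta (σ p) (w₁.1 p) (w₂.1 p) (w₁.2 p) (w₂.2 p)) *
        ∏ p, pairDelta (τ p) (legIn pred w₁.1 p) (legIn pred w₂.1 p) (legIn pred w₁.2 p)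
          (legIn pred w₂.2 p))) =
      ∏ p, (D : ℝ) ^ numCycles (σ p * ((succ p).elim 1 τ)⁻¹) := by
  have h1 : ∀ w₁ w₂ : (P → Fin D) × (P → Fin D),
      (bdry succ w₁.1 w₁.2 * bdry succ w₂.1 w₂.2 *
        ((∏ p, pairDelta (σ p) (w₁.1 p) (w₂.1 p) (w₁.2 p) (w₂.2 p)) *
        ∏ p, pairDelta (τ p) (legIn pred w₁.1 p) (legIn pred w₂.1 p) (legIn pred w₁.2 p)
          (legIn pred w₂.2 p))) =
      ∏ p, (pairDelta (σ p) (w₁.1 p) (w₂.1 p) (w₁.2 p) (w₂.2 p) *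
        pairDelta ((succ p).elim 1 τ) (w₁.1 p) (w₂.1 p) (w₁.2 p) (w₂.2 p)) := by
    intro w₁ w₂
    rw [Finset.prod_mul_distrib, ← prod_legIn h]
    ring
  simp_rw [h1, Fintype.sum_prod_type]
  have hcard : (D : ℝ) = (Fintype.card (Fin D) : ℝ) := by simp
  simp_rw [hcard, ← sum_pairDelta_mul, ← sum_pi_prod]

end Bonds

/-! ### Lattice adjacency and overlaps of physical configurations -/

variable {d D m n : ℕ}

/-- The site to the left. -/
def leftSite (p : Site m n) : Option (Site m n) :=
  if p.2.val = 0 then none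
  else some (p.1, ⟨p.2.val - 1, lt_of_le_of_lt (Nat.sub_le _ _) p.2.isLt⟩)

/-- The site below. -/
def downSite (p : Site m n) : Option (Site m n) :=
  if p.1.val = 0 then none
  else some (⟨p.1.val - 1, lt_of_le_of_lt (Nat.sub_le _ _) p.1.isLt⟩, p.2)

/-- The site to the right. -/
def rightSite (p : Site m n) : Option (Site m n) :=
  if h : p.2.val + 1 < n then some (p.1, ⟨p.2.val + 1, h⟩) else none

/-- The site above. -/
def upSite (p : Site m n) : Option (Site m n) :=
  if h : p.1.val + 1 < m then some (⟨p.1.val + 1, h⟩, p.2) else none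

lemma leftSite_eq_some_iff (p q : Site m n) : leftSite p = some q ↔ rightSite q = some p := by
  obtain ⟨⟨p1, hp1⟩, ⟨p2, hp2⟩⟩ := p
  obtain ⟨⟨q1, hq1⟩, ⟨q2, hq2⟩⟩ := q
  unfold leftSite rightSite
  split_ifs with h1 h2 h2 <;> simp at * <;> omega

lemma downSite_eq_some_iff (p q : Site m n) : downSite p = some q ↔ upSite q = some p := by
  obtain ⟨⟨p1, hp1⟩, ⟨p2, hp2⟩⟩ := p
  obtain ⟨⟨q1, hq1⟩, ⟨q2, hq2⟩⟩ := q
  unfold downSite upSite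
  split_ifs with h1 h2 h2 <;> simp at * <;> omega

lemma rightSite_eq_none_iff (p : Site m n) : rightSite p = none ↔ p.2.val + 1 = n := by
  unfold rightSite
  have := p.2.isLt
  split_ifs with h <;> simp <;> omega

lemma upSite_eq_none_iff (p : Site m n) : upSite p = none ↔ p.1.val + 1 = m := by
  unfold upSite
  have := p.1.isLt
  split_ifs with h <;> simp <;> omega

lemma leftIn_eq_legIn [NeZero D] (R : Site m n → Fin D) (p : Site m n) :
    leftIn R p = legIn leftSite R p := by
  unfold leftIn legIn leftSite
  split_ifs <;> rfl

lemma downIn_eq_legIn [NeZero D] (R : Site m n → Fin D) (p : Site m n) :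
    downIn R p = legIn downSite R p := by
  unfold downIn legIn downSite
  split_ifs <;> rfl

variable [NeZero d] [NeZero D]

/-- The configuration that is `a` on `A` and `b` off `A`. -/
def mix (A : Finset (Site m n)) (a b : Site m n → Fin d) : Site m n → Fin d :=
  fun p => if p ∈ A then a p else b p

/-- The overlap of two physical configurations after tracing out the ancillas. -/
def overlap (U : Site m n → Gate d D) (a a' : Site m n → Fin d) : ℂ :=
  ∑ x : Fin m → Fin D, ∑ y : Fin n → Fin D, amplitude U a x y * star (amplitude U a' x y)

/-- The purity is the expectation of the swap on `A` in two copies of the state: each bra takes its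
configuration on `A` from the other copy. Full configurations as summation variables later let the
sum factor over sites. -/
lemma trace_reducedState_sq (U : Site m n → Gate d D) (A : Finset (Site m n)) :
    (reducedState U A * reducedState U A).trace =
      ∑ a₁ : Site m n → Fin d, ∑ a₂ : Site m n → Fin d,
        overlap U a₁ (mix A a₂ a₁) * overlap U a₂ (mix A a₁ a₂) := by
  have hsum : ∀ F : (Site m n → Fin d) → ℂ, ∑ a, F a =
      ∑ s : {p // p ∈ A} → Fin d, ∑ t : {p // p ∉ A} → Fin d, F (glue A s t) := by
    intro F
    rw [← (Equiv.piEquivPiSubtypeProd (· ∈ A) (fun _ => Fin d)).symm.sum_comp,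
      Fintype.sum_prod_type]
    rfl
  have hmix : ∀ (s s' : {p // p ∈ A} → Fin d) (t t' : {p // p ∉ A} → Fin d),
      mix A (glue A s' t') (glue A s t) = glue A s' t := by
    intro s s' t t'
    ext p
    by_cases hp : p ∈ A <;> simp [mix, glue, hp]
  simp_rw [hsum, hmix]
  simp only [Matrix.trace, Matrix.diag_apply, Matrix.mul_apply, reducedState, Matrix.of_apply]
  refine Finset.sum_congr rfl fun s _ => ?_
  rw [Finset.sum_comm]
  refine Finset.sum_congr rfl fun s' _ => ?_
  rw [Finset.sum_mul_sum]
  rfl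

/-- The contribution of one site to a product of a ket and a bra amplitude. -/
def siteFactor (a a' : Site m n → Fin d) (v w : (Site m n → Fin D) × (Site m n → Fin D))
    (p : Site m n) (g : Gate d D) : ℂ :=
  g.val (a p, v.1 p, w.1 p) (0, legIn leftSite v.1 p, legIn downSite w.1 p) *
    star (g.val (a' p, v.2 p, w.2 p) (0, legIn leftSite v.2 p, legIn downSite w.2 p))

-- Both indicators pin the ancilla configuration to the last column, so the sum has at most one
-- term, present when ket and bra agree there. For `n = 0` the constraints would be vacuous and the
-- sum would count all `x`.
omit [NeZero D] in
lemma sum_right_boundary (hn : 0 < n) (R R' : Site m n → Fin D) :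
    ∑ x : Fin m → Fin D, ((if ∀ p : Site m n, p.2.val + 1 = n → R p = x p.1 then 1 else 0 : ℂ) *
      (if ∀ p : Site m n, p.2.val + 1 = n → R' p = x p.1 then 1 else 0)) =
      (bdry rightSite R R' : ℝ) := by
  have hlast : n - 1 < n := by omega
  have key : ∀ (x : Fin m → Fin D) (S : Site m n → Fin D),
      (∀ p : Site m n, p.2.val + 1 = n → S p = x p.1) ↔ x = fun i => S (i, ⟨n - 1, hlast⟩) := by
    intro x S
    constructor
    · intro h
      ext i
      rw [h (i, ⟨n - 1, hlast⟩) (by simp; omega)]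
    · rintro rfl ⟨i, j⟩ hj
      have : j = ⟨n - 1, hlast⟩ := Fin.ext (by simp at hj ⊢; omega)
      rw [this]
  simp_rw [key]
  rw [Finset.sum_eq_single (fun i => R (i, ⟨n - 1, hlast⟩)) (fun b _ hb => by simp [hb]) (by simp)]
  simp only [if_true, one_mul, bdry, rightSite_eq_none_iff]
  have : ((fun i => R (i, ⟨n - 1, hlast⟩)) = fun i => R' (i, ⟨n - 1, hlast⟩)) ↔
      ∀ p : Site m n, p.2.val + 1 = n → R p = R' p := by
    rw [← key]
    constructor
    · rintro h ⟨i, j⟩ hj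
      have : j = ⟨n - 1, hlast⟩ := Fin.ext (by simp at hj ⊢; omega)
      rw [h _ hj, this]
    · rintro h ⟨i, j⟩ hj
      have : j = ⟨n - 1, hlast⟩ := Fin.ext (by simp at hj ⊢; omega)
      rw [← h _ hj, this]
  simp only [this]
  split_ifs <;> simp

omit [NeZero D] in
lemma sum_top_boundary (hm : 0 < m) (R R' : Site m n → Fin D) :
    ∑ x : Fin n → Fin D, ((if ∀ p : Site m n, p.1.val + 1 = m → R p = x p.2 then 1 else 0 : ℂ) *
      (if ∀ p : Site m n, p.1.val + 1 = m → R' p = x p.2 then 1 else 0)) =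
      (bdry upSite R R' : ℝ) := by
  -- Reflection in the diagonal exchanges the top and the right boundary.
  have h := sum_right_boundary (m := n) (n := m) hm (R ∘ Prod.swap) (R' ∘ Prod.swap)
  have e : ∀ Q : Site m n → Prop, (∀ p : Site n m, Q p.swap) ↔ ∀ p, Q p :=
    fun Q => ⟨fun h p => by simpa using h p.swap, fun h p => h _⟩
  have e1 : ∀ (S : Site m n → Fin D) (x : Fin n → Fin D),
      (∀ p : Site n m, p.2.val + 1 = m → (S ∘ Prod.swap) p = x p.1) ↔
      ∀ p : Site m n, p.1.val + 1 = m → S p = x p.2 :=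
    fun S x => e fun p => p.1.val + 1 = m → S p = x p.2
  simp only [e1] at h
  rw [h]
  simp only [bdry, rightSite_eq_none_iff, upSite_eq_none_iff]
  congr 2
  exact propext (e fun p => p.1.val + 1 = m → R p = R' p)

lemma overlap_eq (hm : 0 < m) (hn : 0 < n) (U : Site m n → Gate d D) (a a' : Site m n → Fin d) :
    overlap U a a' =
      ∑ v : (Site m n → Fin D) × (Site m n → Fin D), ∑ w : (Site m n → Fin D) × (Site m n → Fin D),
        (bdry rightSite v.1 v.2 * bdry upSite w.1 w.2 : ℝ) * ∏ p, siteFactor a a' v w p (U p) := by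
  have hamp : ∀ (s : Site m n → Fin d) (x : Fin m → Fin D) (y : Fin n → Fin D),
      amplitude U s x y = ∑ R : Site m n → Fin D, ∑ V : Site m n → Fin D,
        (if ∀ p : Site m n, p.2.val + 1 = n → R p = x p.1 then 1 else 0 : ℂ) *
        (if ∀ p : Site m n, p.1.val + 1 = m → V p = y p.2 then 1 else 0 : ℂ) *
        ∏ p : Site m n, (U p).val (s p, R p, V p) (0, legIn leftSite R p, legIn downSite V p) := by
    intro s x y
    unfold amplitude
    simp_rw [leftIn_eq_legIn, downIn_eq_legIn]
    refine Finset.sum_congr rfl fun R _ => Finset.sum_congr rfl fun V _ => ?_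
    by_cases h1 : ∀ p : Site m n, p.2.val + 1 = n → R p = x p.1
    · by_cases h2 : ∀ p : Site m n, p.1.val + 1 = m → V p = y p.2
      · rw [if_pos ⟨h1, h2⟩, if_pos h1, if_pos h2, one_mul, one_mul]
      · rw [if_neg (fun h => h2 h.2), if_neg h2, mul_zero, zero_mul]
    · rw [if_neg (fun h => h1 h.1), if_neg h1, zero_mul, zero_mul]
  unfold overlap
  simp_rw [hamp, star_sum, Finset.sum_mul_sum]
  simp_rw [Fintype.sum_prod_type]
  -- The ancilla sums are moved innermost, where they collapse to the boundary indicators.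
  have hre : ∀ F : (Fin m → Fin D) → (Fin n → Fin D) → (Site m n → Fin D) → (Site m n → Fin D) →
      (Site m n → Fin D) → (Site m n → Fin D) → ℂ,
      ∑ x, ∑ y, ∑ R, ∑ R', ∑ V, ∑ V', F x y R R' V V' =
      ∑ R, ∑ R', ∑ V, ∑ V', ∑ x, ∑ y, F x y R R' V V' := by
    intro F
    have c : ∀ {α β : Type} [Fintype α] [Fintype β] (G : (Fin m → Fin D) → (Fin n → Fin D) → α → ℂ),
        ∑ x, ∑ y, ∑ r, G x y r = ∑ r, ∑ x, ∑ y, G x y r := by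
      intro α β _ _ G
      rw [Finset.sum_comm]
      simp_rw [Finset.sum_comm (s := (Finset.univ : Finset (Fin m → Fin D)))]
      rw [Finset.sum_comm]
    have h := c (α := ((Site m n → Fin D) × (Site m n → Fin D) × (Site m n → Fin D) ×
      (Site m n → Fin D))) (β := Unit) fun x y r => F x y r.1 r.2.1 r.2.2.1 r.2.2.2
    simpa only [Fintype.sum_prod_type] using h
  rw [hre]
  refine Finset.sum_congr rfl fun R _ => Finset.sum_congr rfl fun R' _ =>
    Finset.sum_congr rfl fun V _ => Finset.sum_congr rfl fun V' _ => ?_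
  push_cast
  rw [← sum_right_boundary hn, ← sum_top_boundary hm, Finset.sum_mul_sum, Finset.sum_mul]
  refine Finset.sum_congr rfl fun x _ => ?_
  rw [Finset.sum_mul]
  refine Finset.sum_congr rfl fun y _ => ?_
  have hs : ∀ Q : Prop, ∀ [Decidable Q], star (if Q then 1 else 0 : ℂ) = if Q then 1 else 0 := by
    intro Q _; split_ifs <;> simp
  simp only [star_mul', hs, star_prod, siteFactor, Finset.prod_mul_distrib]
  ring

end

/-! ### The averaged purity as an `S₂` spin model -/

section

open MeasureTheory

variable {d D m n : ℕ} [NeZero d] [NeZero D]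

lemma continuous_siteFactor (a a' : Site m n → Fin d)
    (v w : (Site m n → Fin D) × (Site m n → Fin D)) (p : Site m n) :
    Continuous (siteFactor a a' v w p) := by
  unfold siteFactor
  exact (continuous_entry _ _).mul (continuous_entry _ _).star

/-- The second moment of the gate at one site, as a sum over pairs of permutations. -/
def siteMoment (σ τ : Equiv.Perm (Fin 2)) (a₁ a₁' a₂ a₂' : Site m n → Fin d)
    (v₁ v₂ w₁ w₂ : (Site m n → Fin D) × (Site m n → Fin D)) (p : Site m n) : ℝ :=
  weingarten 2 (d * D ^ 2) σ τ * pairDelta σ (a₁ p) (a₂ p) (a₁' p) (a₂' p) *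
    (pairDelta σ (v₁.1 p) (v₂.1 p) (v₁.2 p) (v₂.2 p) *
      pairDelta τ (legIn leftSite v₁.1 p) (legIn leftSite v₂.1 p) (legIn leftSite v₁.2 p)
        (legIn leftSite v₂.2 p)) *
    (pairDelta σ (w₁.1 p) (w₂.1 p) (w₁.2 p) (w₂.2 p) *
      pairDelta τ (legIn downSite w₁.1 p) (legIn downSite w₂.1 p) (legIn downSite w₁.2 p)
        (legIn downSite w₂.2 p))

/-- The four gate entries at a site form one second moment. The physical input is 0 in all of them,
so its delta is 1 for either permutation and leaves no trace. -/
lemma integral_siteFactor (hd : 2 ≤ d) (hD : 2 ≤ D) (a₁ a₁' a₂ a₂' : Site m n → Fin d)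
    (v₁ v₂ w₁ w₂ : (Site m n → Fin D) × (Site m n → Fin D)) (p : Site m n) :
    ∫ g, siteFactor a₁ a₁' v₁ w₁ p g * siteFactor a₂ a₂' v₂ w₂ p g ∂gateHaar d D =
      ((∑ σ, ∑ τ, siteMoment σ τ a₁ a₁' a₂ a₂' v₁ v₂ w₁ w₂ p : ℝ) : ℂ) := by
  have h : ∀ g : Gate d D, siteFactor a₁ a₁' v₁ w₁ p g * siteFactor a₂ a₂' v₂ w₂ p g =
      momentFun (a₁ p, v₁.1 p, w₁.1 p) (a₂ p, v₂.1 p, w₂.1 p) (a₁' p, v₁.2 p, w₁.2 p)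
        (a₂' p, v₂.2 p, w₂.2 p)
        (0, legIn leftSite v₁.1 p, legIn downSite w₁.1 p)
        (0, legIn leftSite v₂.1 p, legIn downSite w₂.1 p)
        (0, legIn leftSite v₁.2 p, legIn downSite w₁.2 p)
        (0, legIn leftSite v₂.2 p, legIn downSite w₂.2 p) g := by
    intro g
    unfold siteFactor momentFun
    ring
  simp_rw [h]
  refine (moment_eq_weingarten hd hD _ _ _ _ _ _ _ _).trans ?_
  congr 1
  refine Finset.sum_congr rfl fun σ _ => Finset.sum_congr rfl fun τ _ => ?_
  simp only [pairDelta_prod, pairDelta_self, siteMoment]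
  ring

/-- The second moment of a product of overlaps, with the bonds still to be summed over. -/
lemma integral_overlap_mul (hd : 2 ≤ d) (hD : 2 ≤ D) (hm : 0 < m) (hn : 0 < n)
    (a₁ a₁' a₂ a₂' : Site m n → Fin d) :
    Integrable (fun U : Site m n → Gate d D => overlap U a₁ a₁' * overlap U a₂ a₂')
      (Measure.pi fun _ => gateHaar d D) ∧
    ∫ U : Site m n → Gate d D, overlap U a₁ a₁' * overlap U a₂ a₂'
      ∂(Measure.pi fun _ => gateHaar d D) =
      ((∑ v₁ : (Site m n → Fin D) × (Site m n → Fin D),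
        ∑ w₁ : (Site m n → Fin D) × (Site m n → Fin D),
        ∑ v₂ : (Site m n → Fin D) × (Site m n → Fin D),
        ∑ w₂ : (Site m n → Fin D) × (Site m n → Fin D),
          (bdry rightSite v₁.1 v₁.2 * bdry upSite w₁.1 w₁.2) *
          (bdry rightSite v₂.1 v₂.2 * bdry upSite w₂.1 w₂.2) *
          ∏ p, ∑ σ, ∑ τ, siteMoment σ τ a₁ a₁' a₂ a₂' v₁ v₂ w₁ w₂ p : ℝ) : ℂ) := by
  have h : ∀ U : Site m n → Gate d D, overlap U a₁ a₁' * overlap U a₂ a₂' =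
      ∑ v₁ : (Site m n → Fin D) × (Site m n → Fin D),
      ∑ w₁ : (Site m n → Fin D) × (Site m n → Fin D),
      ∑ v₂ : (Site m n → Fin D) × (Site m n → Fin D),
      ∑ w₂ : (Site m n → Fin D) × (Site m n → Fin D),
        (((bdry rightSite v₁.1 v₁.2 * bdry upSite w₁.1 w₁.2) *
          (bdry rightSite v₂.1 v₂.2 * bdry upSite w₂.1 w₂.2) : ℝ) : ℂ) *
          ∏ p, (siteFactor a₁ a₁' v₁ w₁ p (U p) * siteFactor a₂ a₂' v₂ w₂ p (U p)) := by
    intro U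
    rw [overlap_eq hm hn, overlap_eq hm hn, Finset.sum_mul]
    refine Finset.sum_congr rfl fun v₁ _ => ?_
    rw [Finset.sum_mul]
    refine Finset.sum_congr rfl fun w₁ _ => ?_
    rw [Finset.mul_sum]
    refine Finset.sum_congr rfl fun v₂ _ => ?_
    rw [Finset.mul_sum]
    refine Finset.sum_congr rfl fun w₂ _ => ?_
    rw [Finset.prod_mul_distrib]
    push_cast
    ring
  have hint : ∀ (v₁ w₁ v₂ w₂ : (Site m n → Fin D) × (Site m n → Fin D)),
      Integrable (fun U : Site m n → Gate d D =>
        (((bdry rightSite v₁.1 v₁.2 * bdry upSite w₁.1 w₁.2) *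
          (bdry rightSite v₂.1 v₂.2 * bdry upSite w₂.1 w₂.2) : ℝ) : ℂ) *
          ∏ p, (siteFactor a₁ a₁' v₁ w₁ p (U p) * siteFactor a₂ a₂' v₂ w₂ p (U p)))
        (Measure.pi fun _ => gateHaar d D) := by
    intro v₁ w₁ v₂ w₂
    refine Integrable.const_mul ?_ _
    exact Integrable.fintype_prod (f := fun p g =>
      siteFactor a₁ a₁' v₁ w₁ p g * siteFactor a₂ a₂' v₂ w₂ p g) fun p =>
      integrable_of_continuous ((continuous_siteFactor _ _ _ _ _).mul
        (continuous_siteFactor _ _ _ _ _))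
  simp_rw [h]
  constructor
  · exact integrable_finsetSum _ fun v₁ _ => integrable_finsetSum _ fun w₁ _ =>
      integrable_finsetSum _ fun v₂ _ => integrable_finsetSum _ fun w₂ _ => hint v₁ w₁ v₂ w₂
  · rw [integral_finsetSum _ fun v₁ _ => integrable_finsetSum _ fun w₁ _ =>
      integrable_finsetSum _ fun v₂ _ => integrable_finsetSum _ fun w₂ _ => hint v₁ w₁ v₂ w₂]
    simp_rw [integral_finsetSum Finset.univ fun w₁ _ =>
      integrable_finsetSum Finset.univ fun v₂ _ => integrable_finsetSum Finset.univ fun w₂ _ =>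
      hint _ w₁ v₂ w₂]
    simp_rw [integral_finsetSum Finset.univ fun v₂ _ => integrable_finsetSum Finset.univ
      fun w₂ _ => hint _ _ v₂ w₂]
    simp_rw [integral_finsetSum Finset.univ fun w₂ _ => hint _ _ _ w₂]
    rw [Complex.ofReal_sum]
    refine Finset.sum_congr rfl fun v₁ _ => ?_
    rw [Complex.ofReal_sum]
    refine Finset.sum_congr rfl fun w₁ _ => ?_
    rw [Complex.ofReal_sum]
    refine Finset.sum_congr rfl fun v₂ _ => ?_
    rw [Complex.ofReal_sum]
    refine Finset.sum_congr rfl fun w₂ _ => ?_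
    conv_rhs => rw [Complex.ofReal_mul, Complex.ofReal_prod]
    rw [integral_const_mul]
    congr 1
    rw [integral_fintype_prod_eq_prod (f := fun p g =>
      siteFactor a₁ a₁' v₁ w₁ p g * siteFactor a₂ a₂' v₂ w₂ p g)]
    exact Finset.prod_congr rfl fun p _ => integral_siteFactor hd hD _ _ _ _ _ _ _ _ _

-- On `A` the bra indices are exchanged, which composes the gate permutation with `sw`; this
-- produces the physical permutation `ρ` of the site tensor.
omit [NeZero d] in
lemma sum_physical (A : Finset (Site m n)) (σ : Site m n → Equiv.Perm (Fin 2)) :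
    ∑ a₁ : Site m n → Fin d, ∑ a₂ : Site m n → Fin d,
      ∏ p, pairDelta (σ p) (a₁ p) (a₂ p) (mix A a₂ a₁ p) (mix A a₁ a₂ p) =
      ∏ p, (d : ℝ) ^ numCycles (σ p * (if p ∈ A then sw else 1)) := by
  have h : ∀ p : Site m n, (d : ℝ) ^ numCycles (σ p * (if p ∈ A then sw else 1)) =
      ∑ x₁ : Fin d, ∑ x₂ : Fin d, pairDelta (σ p) x₁ x₂ (if p ∈ A then x₂ else x₁)
        (if p ∈ A then x₁ else x₂) := by
    intro p
    have h3 : ∀ x₁ x₂ : Fin d, (x₁ = x₂ ∧ x₂ = x₁) ↔ x₁ = x₂ :=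
      fun _ _ => ⟨fun h => h.1, fun h => ⟨h, h.symm⟩⟩
    by_cases hp : p ∈ A <;> rcases perm_two_cases (σ p) with hs | hs <;>
      simp [hp, hs, pairDelta, h3, sq]
  simp_rw [h, ← sum_pi_prod]
  rfl

lemma sum_factor {α β γ : Type*} [Fintype α] [Fintype β] [Fintype γ] (c : ℝ) (F : α → α → ℝ)
    (G : β → β → ℝ) (H : γ → γ → ℝ) :
    ∑ a₁, ∑ a₂, ∑ v₁, ∑ w₁, ∑ v₂, ∑ w₂, c * F a₁ a₂ * G v₁ v₂ * H w₁ w₂ =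
      c * (∑ a₁, ∑ a₂, F a₁ a₂) * (∑ v₁, ∑ v₂, G v₁ v₂) * ∑ w₁, ∑ w₂, H w₁ w₂ := by
  have h : ∀ a₁ a₂ v₁, ∑ w₁, ∑ v₂, ∑ w₂, c * F a₁ a₂ * G v₁ v₂ * H w₁ w₂ =
      c * F a₁ a₂ * (∑ v₂, G v₁ v₂) * ∑ w₁, ∑ w₂, H w₁ w₂ := by
    intro a₁ a₂ v₁
    rw [Finset.sum_comm]
    simp_rw [← Finset.mul_sum, ← Finset.sum_mul, ← Finset.mul_sum]
  simp_rw [h, ← Finset.sum_mul, ← Finset.mul_sum, ← Finset.sum_mul, ← Finset.mul_sum]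

lemma sum_comm_six {α β γ S : Type*} [Fintype α] [Fintype β] [Fintype γ] [Fintype S]
    (F : α → α → β → γ → β → γ → S → S → ℝ) :
    ∑ a₁, ∑ a₂, ∑ v₁, ∑ w₁, ∑ v₂, ∑ w₂, ∑ σ, ∑ τ, F a₁ a₂ v₁ w₁ v₂ w₂ σ τ =
      ∑ τ, ∑ σ, ∑ a₁, ∑ a₂, ∑ v₁, ∑ w₁, ∑ v₂, ∑ w₂, F a₁ a₂ v₁ w₁ v₂ w₂ σ τ := by
  have h : ∑ x : α × α × β × γ × β × γ, ∑ y : S × S,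
      F x.1 x.2.1 x.2.2.1 x.2.2.2.1 x.2.2.2.2.1 x.2.2.2.2.2 y.1 y.2 = _ := Finset.sum_comm
  simp only [Fintype.sum_prod_type] at h
  rw [h, Finset.sum_comm]

omit [NeZero d] in
/-- The contraction of all bonds for fixed permutations at the gates. -/
lemma sum_siteMoment (A : Finset (Site m n)) (σ τ : Site m n → Equiv.Perm (Fin 2)) :
    (∑ a₁ : Site m n → Fin d, ∑ a₂ : Site m n → Fin d,
        ∑ v₁ : (Site m n → Fin D) × (Site m n → Fin D),
        ∑ w₁ : (Site m n → Fin D) × (Site m n → Fin D),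
        ∑ v₂ : (Site m n → Fin D) × (Site m n → Fin D),
        ∑ w₂ : (Site m n → Fin D) × (Site m n → Fin D),
          (bdry rightSite v₁.1 v₁.2 * bdry upSite w₁.1 w₁.2) *
          (bdry rightSite v₂.1 v₂.2 * bdry upSite w₂.1 w₂.2) *
          ∏ p, siteMoment (σ p) (τ p) a₁ (mix A a₂ a₁) a₂ (mix A a₁ a₂) v₁ v₂ w₁ w₂ p) =
      ∏ p, (weingarten 2 (d * D ^ 2) (σ p) (τ p) *
        (d : ℝ) ^ numCycles (σ p * (if p ∈ A then sw else 1)) *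
        (D : ℝ) ^ numCycles (σ p * ((rightSite p).elim 1 τ)⁻¹) *
        (D : ℝ) ^ numCycles (σ p * ((upSite p).elim 1 τ)⁻¹)) := by
  simp only [Finset.prod_mul_distrib]
  rw [← sum_physical, ← sum_bonds (leftSite_eq_some_iff (m := m) (n := n)) σ τ,
    ← sum_bonds (downSite_eq_some_iff (m := m) (n := n)) σ τ, ← sum_factor]
  refine Finset.sum_congr rfl fun a₁ _ => Finset.sum_congr rfl fun a₂ _ =>
    Finset.sum_congr rfl fun v₁ _ => Finset.sum_congr rfl fun w₁ _ =>
    Finset.sum_congr rfl fun v₂ _ => Finset.sum_congr rfl fun w₂ _ => ?_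
  simp only [siteMoment, Finset.prod_mul_distrib]
  ring

/-- Independence turns the average into a product of site moments. Expanding these over `σ, τ`
before summing the indices lets every bond be contracted separately, with `σ` from the site it
leaves and `τ` from the site it enters. The sum over `σ` is then local and defines `siteTensor`. -/
theorem expectedPurity_eq (hd : 2 ≤ d) (hD : 2 ≤ D) (hm : 0 < m) (hn : 0 < n)
    (A : Finset (Site m n)) :
    expectedPurity d D m n A = ∑ τ : Site m n → Equiv.Perm (Fin 2), ∏ p,
      siteTensor d D (if p ∈ A then sw else 1) (τ p) ((rightSite p).elim 1 τ)
        ((upSite p).elim 1 τ) := by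
  have h1 : ∀ τ : Site m n → Equiv.Perm (Fin 2), ∏ p,
      siteTensor d D (if p ∈ A then sw else 1) (τ p) ((rightSite p).elim 1 τ)
        ((upSite p).elim 1 τ) = ∑ σ : Site m n → Equiv.Perm (Fin 2), ∏ p,
        (weingarten 2 (d * D ^ 2) (σ p) (τ p) *
        (d : ℝ) ^ numCycles (σ p * (if p ∈ A then sw else 1)) *
        (D : ℝ) ^ numCycles (σ p * ((rightSite p).elim 1 τ)⁻¹) *
        (D : ℝ) ^ numCycles (σ p * ((upSite p).elim 1 τ)⁻¹)) := by
    intro τ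
    simp only [siteTensor]
    rw [← sum_pi_prod (fun (p : Site m n) s => weingarten 2 (d * D ^ 2) s (τ p) *
        (d : ℝ) ^ numCycles (s * (if p ∈ A then sw else 1)) *
        (D : ℝ) ^ numCycles (s * ((rightSite p).elim 1 τ)⁻¹) *
        (D : ℝ) ^ numCycles (s * ((upSite p).elim 1 τ)⁻¹))]
  simp_rw [h1, ← sum_siteMoment]
  have h2 : ∀ U : Site m n → Gate d D, purity U A =
      Complex.reCLM (∑ a₁ : Site m n → Fin d, ∑ a₂ : Site m n → Fin d,
        overlap U a₁ (mix A a₂ a₁) * overlap U a₂ (mix A a₁ a₂)) := by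
    intro U
    rw [← trace_reducedState_sq]
    rfl
  have hint := fun a₁ a₂ : Site m n → Fin d =>
    (integral_overlap_mul hd hD hm hn a₁ (mix A a₂ a₁) a₂ (mix A a₁ a₂)).1
  have hval := fun a₁ a₂ : Site m n → Fin d =>
    (integral_overlap_mul hd hD hm hn a₁ (mix A a₂ a₁) a₂ (mix A a₁ a₂)).2
  unfold expectedPurity
  simp_rw [h2]
  rw [ContinuousLinearMap.integral_comp_comm _ (integrable_finsetSum _ fun a₁ _ =>
    integrable_finsetSum _ fun a₂ _ => hint a₁ a₂),
    integral_finsetSum _ fun a₁ _ => integrable_finsetSum _ fun a₂ _ => hint a₁ a₂]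
  simp_rw [integral_finsetSum Finset.univ fun a₂ _ => hint _ a₂, hval, ← Complex.ofReal_sum]
  rw [Complex.reCLM_apply, Complex.ofReal_re, ← sum_comm_six]
  simp_rw [← Finset.mul_sum]
  have h3 : ∀ G : Site m n → Equiv.Perm (Fin 2) → Equiv.Perm (Fin 2) → ℝ,
      ∑ σ : Site m n → Equiv.Perm (Fin 2), ∑ τ : Site m n → Equiv.Perm (Fin 2),
        ∏ p, G p (σ p) (τ p) = ∏ p, ∑ σ, ∑ τ, G p σ τ := by
    intro G
    rw [← sum_pi_prod]
    exact Finset.sum_congr rfl fun σ _ => sum_pi_prod fun p => G p (σ p)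
  simp_rw [← h3]

end

section

/-! ### Entries of the site tensor -/

section Entries

variable (d D : ℕ)

/-- The site tensor with one `swap` on an outgoing leg and `1` elsewhere. -/
def wOne : ℝ := ((d : ℝ) ^ 2 * (D : ℝ) ^ 3 - D) / ((d : ℝ) ^ 2 * (D : ℝ) ^ 4 - 1)

/-- The site tensor with `swap` on both outgoing legs and `1` elsewhere. -/
def wTwo : ℝ := ((d : ℝ) ^ 2 * (D : ℝ) ^ 2 - (D : ℝ) ^ 2) / ((d : ℝ) ^ 2 * (D : ℝ) ^ 4 - 1)

/-- The site tensor with `swap` on all legs and `1` on the physical system. -/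
def wAll : ℝ := ((d : ℝ) * (D : ℝ) ^ 4 - d) / ((d : ℝ) ^ 2 * (D : ℝ) ^ 4 - 1)

variable {d D}

lemma denom_pos (hd : 2 ≤ d) (hD : 2 ≤ D) : 0 < (d : ℝ) ^ 2 * (D : ℝ) ^ 4 - 1 := by
  have h1 : (2 : ℝ) ≤ d := by exact_mod_cast hd
  have h2 : (2 : ℝ) ≤ D := by exact_mod_cast hD
  have h3 : (2 : ℝ) ^ 2 ≤ (d : ℝ) ^ 2 := by gcongr
  have h4 : (2 : ℝ) ^ 4 ≤ (D : ℝ) ^ 4 := by gcongr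
  nlinarith

/-- In a group of order two, only agreement with `ρ` matters. The entries `1` and `0` for `θ = ν =
ρ` express unitarity: fully contracted outputs pass their permutation to the inputs. Everything
about the geometry of the lattice rests on this zero. -/
lemma siteTensor_eq (hd : 2 ≤ d) (hD : 2 ≤ D) (ρ τ θ ν : Equiv.Perm (Fin 2)) :
    siteTensor d D ρ τ θ ν =
      if τ = ρ then
        if θ = ρ then (if ν = ρ then 1 else wOne d D) else (if ν = ρ then wOne d D else wTwo d D)
      else
        if θ = ρ then (if ν = ρ then 0 else subleading d D)
        else (if ν = ρ then subleading d D else wAll d D) := by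
  have h := denom_pos hd hD
  have h1 : (d : ℝ) ≠ 0 := by have : d ≠ 0 := by omega
                              exact_mod_cast this
  have h2 : (D : ℝ) ≠ 0 := by have : D ≠ 0 := by omega
                              exact_mod_cast this
  have hq : 2 ≤ d * D ^ 2 := by nlinarith [Nat.pow_le_pow_left hD 2]
  have h0 : ((d : ℝ) * (D : ℝ) ^ 2) ^ 2 - 1 ≠ 0 := by
    have : ((d : ℝ) * (D : ℝ) ^ 2) ^ 2 - 1 = (d : ℝ) ^ 2 * (D : ℝ) ^ 4 - 1 := by ring
    rw [this]; exact h.ne'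
  have h' := h.ne'
  rw [siteTensor, sum_perm_two, weingarten_two _ hq, weingarten_two _ hq]
  push_cast
  rcases perm_two_cases ρ with rfl | rfl <;> rcases perm_two_cases τ with rfl | rfl <;>
  rcases perm_two_cases θ with rfl | rfl <;> rcases perm_two_cases ν with rfl | rfl <;>
  simp [wOne, wTwo, wAll, subleading] <;> field_simp <;> ring

lemma subleading_pos (hd : 2 ≤ d) (hD : 2 ≤ D) : 0 < subleading d D := by
  have h1 : (2 : ℝ) ≤ d := by exact_mod_cast hd
  have h2 : (2 : ℝ) ≤ D := by exact_mod_cast hD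
  refine div_pos ?_ (denom_pos hd hD)
  have : (d : ℝ) * (D : ℝ) ^ 3 - d * D = d * D * ((D : ℝ) ^ 2 - 1) := by ring
  rw [this]
  have : 0 < (D : ℝ) ^ 2 - 1 := by nlinarith
  positivity

lemma wOne_pos (hd : 2 ≤ d) (hD : 2 ≤ D) : 0 < wOne d D := by
  have h1 : (2 : ℝ) ≤ d := by exact_mod_cast hd
  have h2 : (2 : ℝ) ≤ D := by exact_mod_cast hD
  refine div_pos ?_ (denom_pos hd hD)
  have : (d : ℝ) ^ 2 * (D : ℝ) ^ 3 - D = D * (((d : ℝ) * D) ^ 2 - 1) := by ring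
  rw [this]
  have : (1 : ℝ) < (d : ℝ) * D := by nlinarith
  have : 0 < ((d : ℝ) * D) ^ 2 - 1 := by nlinarith
  positivity

lemma wTwo_pos (hd : 2 ≤ d) (hD : 2 ≤ D) : 0 < wTwo d D := by
  have h1 : (2 : ℝ) ≤ d := by exact_mod_cast hd
  have h2 : (2 : ℝ) ≤ D := by exact_mod_cast hD
  refine div_pos ?_ (denom_pos hd hD)
  have : (d : ℝ) ^ 2 * (D : ℝ) ^ 2 - (D : ℝ) ^ 2 = (D : ℝ) ^ 2 * ((d : ℝ) ^ 2 - 1) := by ring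
  rw [this]
  have : 0 < (d : ℝ) ^ 2 - 1 := by nlinarith
  positivity

lemma wAll_pos (hd : 2 ≤ d) (hD : 2 ≤ D) : 0 < wAll d D := by
  have h1 : (2 : ℝ) ≤ d := by exact_mod_cast hd
  have h2 : (2 : ℝ) ≤ D := by exact_mod_cast hD
  refine div_pos ?_ (denom_pos hd hD)
  have h4 : (2 : ℝ) ^ 4 ≤ (D : ℝ) ^ 4 := by gcongr
  nlinarith

/-- The gap to 1, times the denominator, factors as `(d D² - 1) (d D - 1) (D - 1)`. -/
lemma wOne_add_subleading_lt_one (hd : 2 ≤ d) (hD : 2 ≤ D) :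
    wOne d D + subleading d D < 1 := by
  have h1 : (2 : ℝ) ≤ d := by exact_mod_cast hd
  have h2 : (2 : ℝ) ≤ D := by exact_mod_cast hD
  rw [wOne, subleading, ← add_div, div_lt_one (denom_pos hd hD)]
  have e : (d : ℝ) ^ 2 * (D : ℝ) ^ 4 - 1 - ((d : ℝ) ^ 2 * (D : ℝ) ^ 3 - D +
      (d * (D : ℝ) ^ 3 - d * D)) = ((d : ℝ) * D ^ 2 - 1) * (((d : ℝ) * D - 1) * (D - 1)) := by ring
  have : 0 < (d : ℝ) * D ^ 2 - 1 := by nlinarith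
  have : 0 < (d : ℝ) * D - 1 := by nlinarith
  have : 0 < (D : ℝ) - 1 := by linarith
  have : 0 < ((d : ℝ) * D ^ 2 - 1) * (((d : ℝ) * D - 1) * (D - 1)) := by positivity
  linarith

/-- Here the gap times the denominator is `(d D² - 1) (d - 1) (D² - 1)`. -/
lemma wTwo_add_wAll_lt_one (hd : 2 ≤ d) (hD : 2 ≤ D) : wTwo d D + wAll d D < 1 := by
  have h1 : (2 : ℝ) ≤ d := by exact_mod_cast hd
  have h2 : (2 : ℝ) ≤ D := by exact_mod_cast hD
  rw [wTwo, wAll, ← add_div, div_lt_one (denom_pos hd hD)]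
  have e : (d : ℝ) ^ 2 * (D : ℝ) ^ 4 - 1 - ((d : ℝ) ^ 2 * (D : ℝ) ^ 2 - (D : ℝ) ^ 2 +
      (d * (D : ℝ) ^ 4 - d)) = ((d : ℝ) * D ^ 2 - 1) * (((d : ℝ) - 1) * (D ^ 2 - 1)) := by ring
  have : 0 < (d : ℝ) * D ^ 2 - 1 := by nlinarith
  have : 0 < (d : ℝ) - 1 := by linarith
  have : 0 < (D : ℝ) ^ 2 - 1 := by nlinarith
  have : 0 < ((d : ℝ) * D ^ 2 - 1) * (((d : ℝ) - 1) * (D ^ 2 - 1)) := by positivity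
  linarith

lemma subleading_lt_one (hd : 2 ≤ d) (hD : 2 ≤ D) : subleading d D < 1 := by
  linarith [wOne_add_subleading_lt_one hd hD, wOne_pos hd hD]

lemma siteTensor_nonneg (hd : 2 ≤ d) (hD : 2 ≤ D) (ρ τ θ ν : Equiv.Perm (Fin 2)) :
    0 ≤ siteTensor d D ρ τ θ ν := by
  have := wOne_pos hd hD
  have := wTwo_pos hd hD
  have := wAll_pos hd hD
  have := subleading_pos hd hD
  rw [siteTensor_eq hd hD]
  split_ifs <;> linarith

end Entries

/-! ### Columns -/

/-- The transfer matrix of a column with site-dependent permutations on the physical systems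
and the permutation `ν` on the upper leg of the last site. -/
def column (d D : ℕ) {h : ℕ} (ρ : Fin h → Equiv.Perm (Fin 2)) (ν : Equiv.Perm (Fin 2)) :
    Matrix (Fin h → Equiv.Perm (Fin 2)) (Fin h → Equiv.Perm (Fin 2)) ℝ :=
  Matrix.of fun τ θ => ∏ i : Fin h,
    siteTensor d D (ρ i) (τ i) (θ i) (if hi : i.val + 1 < h then τ ⟨i.val + 1, hi⟩ else ν)

lemma columnTransfer_eq_column (d D h : ℕ) (ρ : Equiv.Perm (Fin 2)) :
    columnTransfer d D 2 h ρ = column d D (fun _ => ρ) 1 := rfl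

/-- Once the top site is split off, its permutation `x` becomes the boundary value above the rest.
This is why `column` keeps the upper permutation as a parameter. -/
lemma column_snoc (d D : ℕ) {h : ℕ} (ρ : Fin (h + 1) → Equiv.Perm (Fin 2))
    (ν x y : Equiv.Perm (Fin 2)) (τ θ : Fin h → Equiv.Perm (Fin 2)) :
    column d D ρ ν (Fin.snoc τ x : Fin (h + 1) → Equiv.Perm (Fin 2))
        (Fin.snoc θ y : Fin (h + 1) → Equiv.Perm (Fin 2)) =
      column d D (fun i => ρ i.castSucc) x τ θ * siteTensor d D (ρ (Fin.last h)) x y ν := by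
  simp only [column, Matrix.of_apply]
  rw [Fin.prod_univ_castSucc]
  congr 1
  · refine Finset.prod_congr rfl fun i _ => ?_
    simp only [Fin.snoc_castSucc]
    congr 1
    have hi := i.isLt
    rw [dif_pos (by simp)]
    by_cases h1 : i.val + 1 < h
    · rw [dif_pos h1]
      exact Fin.snoc_castSucc (α := fun _ => Equiv.Perm (Fin 2)) x τ ⟨i.val + 1, h1⟩
    · rw [dif_neg h1]
      have : (⟨i.castSucc.val + 1, by simp⟩ : Fin (h + 1)) = Fin.last h :=
        Fin.ext (by simp; omega)
      rw [this, Fin.snoc_last]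
  · simp

/-- The row vector `(1, …, 1) C₀ C₁ ⋯ Cₙ₋₁`. -/
def chain {X : Type*} [Fintype X] (C : ℕ → Matrix X X ℝ) : ℕ → X → ℝ
  | 0 => 1
  | n + 1 => Matrix.vecMul (chain C n) (C n)

/-- The spin of the first column is summed freely, whence the all-ones row vector; the value `e` to
the right of the last column selects an entry. -/
lemma sum_prod_eq_chain {X : Type*} [Fintype X] (C : ℕ → Matrix X X ℝ) (n : ℕ) (e : X) :
    ∑ t : Fin n → X, ∏ j : Fin n, C j (t j) (if hj : j.val + 1 < n then t ⟨j.val + 1, hj⟩ else e) =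
      chain C n e := by
  induction n generalizing e with
  | zero => simp [chain]
  | succ n ih =>
    rw [← (Fin.snocEquiv (fun _ => X)).sum_comp, Fintype.sum_prod_type]
    simp only [chain, Matrix.vecMul, dotProduct, ← ih, Finset.sum_mul]
    refine Finset.sum_congr rfl fun x _ => Finset.sum_congr rfl fun t _ => ?_
    simp only [Fin.snocEquiv, Equiv.coe_fn_mk]
    rw [Fin.prod_univ_castSucc]
    congr 1
    · refine Finset.prod_congr rfl fun i _ => ?_
      simp only [Fin.snoc_castSucc]
      congr 1
      rw [dif_pos (by simp)]
      by_cases h1 : i.val + 1 < n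
      · rw [dif_pos h1]
        exact Fin.snoc_castSucc (α := fun _ => X) x t ⟨i.val + 1, h1⟩
      · rw [dif_neg h1]
        have : (⟨i.castSucc.val + 1, by simp⟩ : Fin (n + 1)) = Fin.last n :=
          Fin.ext (by simp; omega)
        rw [this, Fin.snoc_last]
    · simp

lemma chain_add {X : Type*} [Fintype X] [DecidableEq X] {C : ℕ → Matrix X X ℝ} {n k : ℕ}
    {M : Matrix X X ℝ} (h : ∀ j, n ≤ j → j < n + k → C j = M) :
    chain C (n + k) = Matrix.vecMul (chain C n) (M ^ k) := by
  induction k with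
  | zero => simp
  | succ k ih =>
    rw [← add_assoc, chain, ih fun j h1 h2 => h j h1 (by omega), h (n + k) (by omega) (by omega),
      Matrix.vecMul_vecMul, pow_succ]

/-- The physical permutations of the column `j`, for a subsystem which consists of the `h` lowest
rows in the columns selected by `J`. -/
def slab (h : ℕ) (J : ℕ → Bool) (m j : ℕ) (i : Fin m) : Equiv.Perm (Fin 2) :=
  if i.val < h ∧ J j = true then sw else 1

/-- The added top row lies outside the subsystem and has `1` above it. If its right leg is `1` too,
the zero of the site tensor forces the spin to be `1` with weight 1, so the row freezes from right
to left. -/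
lemma chain_snoc_one {d D : ℕ} (hd : 2 ≤ d) (hD : 2 ≤ D) {h m : ℕ} (hm : h ≤ m) (J : ℕ → Bool)
    (n : ℕ) (θ : Fin m → Equiv.Perm (Fin 2)) :
    chain (fun j => column d D (slab h J (m + 1) j) 1) n
        (Fin.snoc θ 1 : Fin (m + 1) → Equiv.Perm (Fin 2)) =
      chain (fun j => column d D (slab h J m j) 1) n θ := by
  induction n generalizing θ with
  | zero => rfl
  | succ n ih =>
    simp only [chain, Matrix.vecMul, dotProduct]
    rw [← (Fin.snocEquiv (fun _ => Equiv.Perm (Fin 2))).sum_comp, Fintype.sum_prod_type,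
      sum_perm_two]
    have hlast : slab h J (m + 1) n (Fin.last m) = 1 := by simp [slab]; omega
    have hcast : ∀ i : Fin m, slab h J (m + 1) n i.castSucc = slab h J m n i := fun i => rfl
    simp only [Fin.snocEquiv, Equiv.coe_fn_mk, column_snoc, hlast, hcast,
      siteTensor_eq hd hD, if_true, sw_ne_one, if_false, mul_zero, Finset.sum_const_zero, add_zero,
      mul_one, ih]

lemma chain_slab_one {d D : ℕ} (hd : 2 ≤ d) (hD : 2 ≤ D) {h m : ℕ} (hm : h ≤ m) (J : ℕ → Bool)
    (n : ℕ) :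
    chain (fun j => column d D (slab h J m j) 1) n 1 =
      chain (fun j => columnTransfer d D 2 h (if J j then sw else 1)) n 1 := by
  induction m, hm using Nat.le_induction with
  | base =>
    have : (fun j => column d D (slab h J h j) 1) =
        fun j => columnTransfer d D 2 h (if J j then sw else 1) := by
      funext j
      rw [columnTransfer_eq_column]
      congr 1
      funext i
      simp [slab]
    rw [this]
  | succ m hm ih =>
    have : (1 : Fin (m + 1) → Equiv.Perm (Fin 2)) =
        (Fin.snoc (1 : Fin m → Equiv.Perm (Fin 2)) 1 : Fin (m + 1) → Equiv.Perm (Fin 2)) := by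
      funext i
      induction i using Fin.lastCases with
      | last => simp
      | cast i => simp
    rw [← ih, this, chain_snoc_one hd hD hm]

theorem expectedPurity_eq_chain {d D m n h : ℕ} [NeZero d] [NeZero D] (hd : 2 ≤ d) (hD : 2 ≤ D)
    (hm : 0 < m) (hhm : h ≤ m) (hn : 0 < n) (J : ℕ → Bool) (A : Finset (Site m n))
    (hA : ∀ p, p ∈ A ↔ p.1.val < h ∧ J p.2.val = true) :
    expectedPurity d D m n A =
      chain (fun j => columnTransfer d D 2 h (if J j then sw else 1)) n 1 := by
  rw [expectedPurity_eq hd hD hm hn, ← chain_slab_one hd hD hhm, ← sum_prod_eq_chain]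
  let e : (Fin n → Fin m → Equiv.Perm (Fin 2)) ≃ (Site m n → Equiv.Perm (Fin 2)) :=
    { toFun := fun t p => t p.2 p.1
      invFun := fun τ j i => τ (i, j)
      left_inv := fun _ => rfl
      right_inv := fun _ => rfl }
  rw [← e.sum_comp]
  refine Finset.sum_congr rfl fun t _ => ?_
  rw [Fintype.prod_prod_type_right]
  refine Finset.prod_congr rfl fun j _ => ?_
  simp only [column, Matrix.of_apply]
  refine Finset.prod_congr rfl fun i _ => ?_
  have e1 : (if (i, j) ∈ A then sw else 1) = slab h J m j i := by simp [slab, hA]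
  have e2 : (rightSite (i, j)).elim 1 (e t) =
      (if hj : j.val + 1 < n then t ⟨j.val + 1, hj⟩ else 1) i := by
    unfold rightSite
    split_ifs <;> rfl
  have e3 : (upSite (i, j)).elim 1 (e t) =
      if hi : i.val + 1 < m then t j ⟨i.val + 1, hi⟩ else 1 := by
    unfold upSite
    split_ifs <;> rfl
  rw [e1, e2, e3]
  rfl

end

section

open Asymptotics Filter

/-! ### Averaged purities as powers of transfer matrices -/

/-- The configuration space of a cut between two columns. -/
abbrev Cut (h : ℕ) : Type := Fin h → Equiv.Perm (Fin 2)

/-- The boundary vector at the last column. -/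
abbrev vac (h : ℕ) : Cut h → ℝ := Pi.single 1 1

section

variable {d D : ℕ} (hd : 2 ≤ d) (hD : 2 ≤ D)
include hd hD

lemma column_nonneg {h : ℕ} (ρ : Cut h) (ν : Equiv.Perm (Fin 2)) (τ θ : Cut h) :
    0 ≤ column d D ρ ν τ θ := by
  rw [column, Matrix.of_apply]
  exact Finset.prod_nonneg fun _ _ => siteTensor_nonneg hd hD _ _ _ _

end

lemma one_eq_snoc (h : ℕ) :
    (1 : Cut (h + 1)) = (Fin.snoc (1 : Cut h) 1 : Cut (h + 1)) := by
  funext i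
  induction i using Fin.lastCases with
  | last => simp
  | cast i => simp

lemma sum_snoc {h : ℕ} (F : Cut (h + 1) → ℝ) :
    ∑ τ, F τ = (∑ τ : Cut h, F (Fin.snoc τ 1 : Cut (h + 1))) +
      ∑ τ : Cut h, F (Fin.snoc τ sw : Cut (h + 1)) := by
  rw [← (Fin.snocEquiv (fun _ => Equiv.Perm (Fin 2))).sum_comp, Fintype.sum_prod_type,
    sum_perm_two]
  rfl

lemma snoc_cases {h : ℕ} {p : Cut (h + 1) → Prop}
    (h1 : ∀ τ : Cut h, p (Fin.snoc τ 1 : Cut (h + 1)))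
    (h2 : ∀ τ : Cut h, p (Fin.snoc τ sw : Cut (h + 1))) (τ : Cut (h + 1)) : p τ := by
  rw [← Fin.snoc_init_self τ]
  rcases perm_two_cases (τ (Fin.last h)) with e | e <;> rw [e]
  · exact h1 _
  · exact h2 _

lemma snoc_one_eq_one_iff {h : ℕ} (τ : Cut h) :
    (Fin.snoc τ 1 : Cut (h + 1)) = 1 ↔ τ = 1 := by
  rw [one_eq_snoc]
  constructor
  · intro e
    exact (Fin.snoc_injective2 e).1
  · rintro rfl; rfl

lemma snoc_sw_ne_one {h : ℕ} (τ : Cut h) : (Fin.snoc τ sw : Cut (h + 1)) ≠ 1 := by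
  rw [one_eq_snoc]
  intro e
  exact sw_ne_one (Fin.snoc_injective2 e).2

lemma vac_snoc_one {h : ℕ} (τ : Cut h) : vac (h + 1) (Fin.snoc τ 1 : Cut (h + 1)) = vac h τ := by
  simp only [Pi.single_apply, snoc_one_eq_one_iff]

lemma vac_snoc_sw {h : ℕ} (τ : Cut h) : vac (h + 1) (Fin.snoc τ sw : Cut (h + 1)) = 0 := by
  simp [snoc_sw_ne_one]

lemma columnTransfer_snoc {d D : ℕ} {h : ℕ} (x y : Equiv.Perm (Fin 2)) (τ θ : Cut h) :
    columnTransfer d D 2 (h + 1) 1 (Fin.snoc τ x : Cut (h + 1)) (Fin.snoc θ y : Cut (h + 1)) =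
      column d D (fun _ => 1) x τ θ * siteTensor d D 1 x y 1 := by
  rw [columnTransfer_eq_column, column_snoc]

section

variable {d D : ℕ} (hd : 2 ≤ d) (hD : 2 ≤ D)
include hd hD

lemma columnTransfer_apply_one {h : ℕ} (τ : Cut h) :
    columnTransfer d D 2 h 1 τ 1 = vac h τ := by
  induction h with
  | zero =>
    have : τ = 1 := Subsingleton.elim _ _
    simp [columnTransfer, this]
  | succ h ih =>
    refine snoc_cases (p := fun τ => columnTransfer d D 2 (h + 1) 1 τ 1 = vac (h + 1) τ)
      (fun τ => ?_) (fun τ => ?_) τ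
    · rw [vac_snoc_one, ← ih, one_eq_snoc, columnTransfer_snoc, siteTensor_eq hd hD]
      simp [columnTransfer_eq_column]
    · rw [vac_snoc_sw, one_eq_snoc, columnTransfer_snoc, siteTensor_eq hd hD]
      simp

/-- This removes the columns to the right of the last block, hence the dependence on `f`. -/
lemma columnTransfer_mulVec_vac (h : ℕ) :
    (columnTransfer d D 2 h 1).mulVec (vac h) = vac h := by
  ext τ
  rw [Matrix.mulVec_single_one]
  exact columnTransfer_apply_one hd hD τ

lemma columnTransfer_pow_mulVec_vac (h k : ℕ) :
    (columnTransfer d D 2 h 1 ^ k).mulVec (vac h) = vac h := by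
  induction k with
  | zero => rw [pow_zero, Matrix.one_mulVec]
  | succ k ih => rw [pow_succ, ← Matrix.mulVec_mulVec, columnTransfer_mulVec_vac hd hD, ih]

variable [NeZero d] [NeZero D]

/-- The averaged purity of two consecutive blocks of the same height. -/
lemma expectedPurity_two_blocks {m h c a r b f : ℕ} (hm : h < m) (hf : 1 ≤ f)
    (J : ℕ → Bool) (A : Finset (Site m (c + a + r + b + f)))
    (hA : ∀ p, p ∈ A ↔ p.1.val < h ∧ J p.2.val = true)
    {x y : Equiv.Perm (Fin 2)}
    (h0 : ∀ j, j < c → J j = false)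
    (h1 : ∀ j, c ≤ j → j < c + a → (if J j then sw else 1) = x)
    (h2 : ∀ j, c + a ≤ j → j < c + a + r → J j = false)
    (h3 : ∀ j, c + a + r ≤ j → j < c + a + r + b → (if J j then sw else 1) = y)
    (h4 : ∀ j, c + a + r + b ≤ j → J j = false) :
    expectedPurity d D m (c + a + r + b + f) A =
      Matrix.vecMul 1 (columnTransfer d D 2 h 1 ^ c) ⬝ᵥ
        (columnTransfer d D 2 h x ^ a).mulVec ((columnTransfer d D 2 h 1 ^ r).mulVec
          ((columnTransfer d D 2 h y ^ b).mulVec (vac h))) := by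
  rw [expectedPurity_eq_chain hd hD (by omega) hm.le (by omega) J A hA]
  rw [chain_add (n := c + a + r + b) (k := f) (M := columnTransfer d D 2 h 1)
      (fun j hj _ => by simp [h4 j hj]),
    chain_add (n := c + a + r) (k := b) (M := columnTransfer d D 2 h y)
      (fun j hj hj' => by rw [h3 j hj hj']),
    chain_add (n := c + a) (k := r) (M := columnTransfer d D 2 h 1)
      (fun j hj hj' => by simp [h2 j hj hj']),
    chain_add (n := c) (k := a) (M := columnTransfer d D 2 h x)
      (fun j hj hj' => by rw [h1 j hj hj'])]
  have hc : chain (fun j => columnTransfer d D 2 h (if J j then sw else 1)) c =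
      Matrix.vecMul 1 (columnTransfer d D 2 h 1 ^ c) := by
    have := chain_add (C := fun j => columnTransfer d D 2 h (if J j then sw else 1)) (n := 0)
      (k := c) (M := columnTransfer d D 2 h 1) (fun j _ hj' => by simp [h0 j (by omega)])
    rw [zero_add] at this
    rw [this]
    rfl
  rw [hc]
  -- The entry at `1` is read as the pairing with `vac`, which the last `f` columns fix.
  refine (dotProduct_single_one _ (1 : Cut h)).symm.trans ?_
  simp only [← Matrix.dotProduct_mulVec]
  rw [columnTransfer_pow_mulVec_vac hd hD]

end

/-! ### Column sums -/

/-- A bound on the averaged purity of one or two of the bonds leaving a site. -/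
def contraction (d D : ℕ) : ℝ := max (wOne d D + subleading d D) (wTwo d D + wAll d D)

section

variable {d D : ℕ} (hd : 2 ≤ d) (hD : 2 ≤ D)
include hd hD

lemma contraction_pos : 0 < contraction d D :=
  lt_max_of_lt_left (add_pos (wOne_pos hd hD) (subleading_pos hd hD))

lemma contraction_lt_one : contraction d D < 1 :=
  max_lt (wOne_add_subleading_lt_one hd hD) (wTwo_add_wAll_lt_one hd hD)

lemma siteTensor_colSum_le_one (y ν : Equiv.Perm (Fin 2)) :
    siteTensor d D 1 1 y ν + siteTensor d D 1 sw y ν ≤ 1 := by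
  have h1 := wOne_add_subleading_lt_one hd hD
  have h2 := wTwo_add_wAll_lt_one hd hD
  rw [siteTensor_eq hd hD, siteTensor_eq hd hD]
  rcases perm_two_cases y with rfl | rfl <;> rcases perm_two_cases ν with rfl | rfl <;>
    simp <;> linarith

lemma siteTensor_colSum_sw_le (y : Equiv.Perm (Fin 2)) :
    siteTensor d D 1 1 y sw + siteTensor d D 1 sw y sw ≤ contraction d D := by
  rw [siteTensor_eq hd hD, siteTensor_eq hd hD]
  rcases perm_two_cases y with rfl | rfl <;> simp [contraction]

lemma sum_column_le_one {h : ℕ} (ν : Equiv.Perm (Fin 2)) (θ : Cut h) :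
    ∑ τ, column d D (fun _ => 1) ν τ θ ≤ 1 := by
  induction h generalizing ν with
  | zero => simp [column]
  | succ h ih =>
    rw [sum_snoc, ← Fin.snoc_init_self θ]
    simp only [column_snoc, ← Finset.sum_mul]
    refine le_trans (add_le_add (mul_le_of_le_one_left (siteTensor_nonneg hd hD _ _ _ _) (ih _ _))
      (mul_le_of_le_one_left (siteTensor_nonneg hd hD _ _ _ _) (ih _ _))) ?_
    exact siteTensor_colSum_le_one hd hD _ _

/-- The top site alone supplies the strict contraction; the sites below it contribute at most 1. The
height must be positive: an empty column has sum 1, and this exception produces the eigenvalue `λ₂`.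
-/
lemma sum_column_sw_le {h : ℕ} (θ : Cut (h + 1)) :
    ∑ τ, column d D (fun _ => 1) sw τ θ ≤ contraction d D := by
  rw [sum_snoc, ← Fin.snoc_init_self θ]
  simp only [column_snoc, ← Finset.sum_mul]
  refine le_trans (add_le_add (mul_le_of_le_one_left (siteTensor_nonneg hd hD _ _ _ _)
    (sum_column_le_one hd hD _ _)) (mul_le_of_le_one_left (siteTensor_nonneg hd hD _ _ _ _)
    (sum_column_le_one hd hD _ _))) ?_
  exact siteTensor_colSum_sw_le hd hD _

/-- The column with `swap` above contracts the `ℓ¹` norm. -/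
lemma sum_norm_column_sw_le {h : ℕ} {E : Type*} [NormedRing E] [NormedAlgebra ℝ E]
    (w : Cut (h + 1) → E) :
    ∑ τ, ‖∑ θ, algebraMap ℝ E (column d D (fun _ => 1) sw τ θ) * w θ‖ ≤
      contraction d D * ∑ θ, ‖w θ‖ := by
  calc ∑ τ, ‖∑ θ, algebraMap ℝ E (column d D (fun _ => 1) sw τ θ) * w θ‖
      ≤ ∑ τ, ∑ θ, column d D (fun _ => 1) sw τ θ * ‖w θ‖ := by
        refine Finset.sum_le_sum fun τ _ => (norm_sum_le _ _).trans
          (Finset.sum_le_sum fun θ _ => ?_)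
        rw [← Algebra.smul_def, norm_smul, Real.norm_of_nonneg (column_nonneg hd hD _ _ _ _)]
    _ = ∑ θ, (∑ τ, column d D (fun _ => 1) sw τ θ) * ‖w θ‖ := by
        rw [Finset.sum_comm]
        simp_rw [Finset.sum_mul]
    _ ≤ ∑ θ, contraction d D * ‖w θ‖ :=
        Finset.sum_le_sum fun θ _ => mul_le_mul_of_nonneg_right
          (sum_column_sw_le hd hD θ) (norm_nonneg _)
    _ = _ := by rw [Finset.mul_sum]

/-! ### The spectrum of the transfer matrix -/

/-- An eigenvector is compared with its image in the `ℓ¹` norm, which the column with `sw` above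
contracts by `contraction d D < 1`. -/
lemma norm_root_charpoly_column_sw_lt {h : ℕ} {z : ℂ}
    (hz : ((Matrix.of fun τ θ : Cut (h + 1) =>
      ((subleading d D * column d D (fun _ => 1) sw τ θ : ℝ) : ℂ)).charpoly).IsRoot z) :
    ‖z‖ < subleading d D := by
  rw [Polynomial.IsRoot, Matrix.eval_charpoly] at hz
  obtain ⟨w, hw0, hw⟩ := Matrix.exists_mulVec_eq_zero_iff.mpr hz
  have hs := subleading_pos hd hD
  have hw' : ∀ τ, z * w τ = (subleading d D : ℂ) *
      ∑ θ, algebraMap ℝ ℂ (column d D (fun _ => 1) sw τ θ) * w θ := by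
    intro τ
    have := congrFun hw τ
    rw [Matrix.sub_mulVec, Pi.sub_apply, Matrix.scalar_apply, Matrix.mulVec_diagonal,
      Pi.zero_apply, sub_eq_zero] at this
    rw [this, Finset.mul_sum]
    refine Finset.sum_congr rfl fun θ _ => ?_
    simp [mul_assoc]
  have h1 : ‖z‖ * ∑ τ, ‖w τ‖ ≤ subleading d D * (contraction d D * ∑ τ, ‖w τ‖) := by
    refine le_trans (le_of_eq ?_)
      (mul_le_mul_of_nonneg_left (sum_norm_column_sw_le hd hD w) hs.le)
    rw [Finset.mul_sum, Finset.mul_sum]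
    refine Finset.sum_congr rfl fun τ _ => ?_
    rw [← norm_mul, hw', norm_mul, Complex.norm_real, Real.norm_of_nonneg hs.le]
  have h2 : 0 < ∑ τ, ‖w τ‖ := by
    obtain ⟨τ, hτ⟩ := Function.ne_iff.mp hw0
    exact Finset.sum_pos' (fun _ _ => norm_nonneg _) ⟨τ, Finset.mem_univ _, norm_pos_iff.mpr hτ⟩
  have h3 : ‖z‖ ≤ subleading d D * contraction d D := by
    rw [← mul_assoc] at h1
    exact le_of_mul_le_mul_right h1 h2
  have := contraction_lt_one hd hD
  nlinarith

/-- The cuts of height `h + 1`, according to the permutation at the top. -/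
def cutEquiv (h : ℕ) : Cut h ⊕ Cut h ≃ Cut (h + 1) :=
  (Equiv.boolProdEquivSum (Cut h)).symm.trans
    ((Equiv.prodCongr
      { toFun := fun b : Bool => if b then sw else 1
        invFun := fun σ => decide (σ = sw)
        left_inv := by decide
        right_inv := by decide } (Equiv.refl _)).trans
      (Fin.snocEquiv fun _ : Fin (h + 1) => Equiv.Perm (Fin 2)))

omit hd hD in
lemma cutEquiv_inl {h : ℕ} (τ : Cut h) :
    cutEquiv h (Sum.inl τ) = (Fin.snoc τ 1 : Cut (h + 1)) := rfl

omit hd hD in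
lemma cutEquiv_inr {h : ℕ} (τ : Cut h) :
    cutEquiv h (Sum.inr τ) = (Fin.snoc τ sw : Cut (h + 1)) := rfl

/-- The block from top spin `sw` to top spin `1` vanishes by the zero of the site tensor, so the
matrix is block triangular. A top spin `1` leaves the shorter transfer matrix; a top spin `sw` has
weight `λ₂` and places `sw` above the rest. -/
lemma charpoly_columnTransfer_succ (h : ℕ) :
    ((columnTransfer d D 2 (h + 1) 1).map (algebraMap ℝ ℂ)).charpoly =
      ((columnTransfer d D 2 h 1).map (algebraMap ℝ ℂ)).charpoly *
        (Matrix.of fun τ θ : Cut h =>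
          ((subleading d D * column d D (fun _ => 1) sw τ θ : ℝ) : ℂ)).charpoly := by
  rw [← Matrix.charpoly_reindex (cutEquiv h).symm,
    ← Matrix.charpoly_fromBlocks_zero₂₁ _ (Matrix.of fun τ θ : Cut h =>
      ((columnTransfer d D 2 (h + 1) 1 (Fin.snoc τ 1 : Cut (h + 1))
        (Fin.snoc θ sw : Cut (h + 1)) : ℝ) : ℂ))]
  congr 1
  ext (τ | τ) (θ | θ)
  · simp [cutEquiv_inl, column_snoc, siteTensor_eq hd hD, columnTransfer_eq_column]
  · simp [cutEquiv_inl, cutEquiv_inr]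
  · simp [cutEquiv_inl, cutEquiv_inr, columnTransfer_snoc, siteTensor_eq hd hD]
  · simp [cutEquiv_inr, columnTransfer_snoc, siteTensor_eq hd hD, mul_comm]

lemma exists_charpoly_eq (h : ℕ) : ∃ p : Polynomial ℂ,
    ((columnTransfer d D 2 (h + 1) 1).map (algebraMap ℝ ℂ)).charpoly =
      (Polynomial.X - Polynomial.C 1) * (Polynomial.X - Polynomial.C (subleading d D : ℂ)) * p ∧
    p ≠ 0 ∧ ∀ z, p.IsRoot z → ‖z‖ < subleading d D := by
  induction h with
  | zero =>
    refine ⟨1, ?_, one_ne_zero, fun z hz => by simp at hz⟩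
    rw [charpoly_columnTransfer_succ hd hD, mul_one]
    congr 1
    · rw [Matrix.charpoly, Matrix.det_unique, Matrix.charmatrix_apply_eq]
      simp [columnTransfer]
    · rw [Matrix.charpoly, Matrix.det_unique, Matrix.charmatrix_apply_eq]
      simp [column]
  | succ h ih =>
    obtain ⟨p, hp, hp0, hpr⟩ := ih
    refine ⟨p * (Matrix.of fun τ θ : Cut (h + 1) =>
      ((subleading d D * column d D (fun _ => 1) sw τ θ : ℝ) : ℂ)).charpoly, ?_, mul_ne_zero hp0 (Matrix.charpoly_monic _).ne_zero, fun z hz => ?_⟩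
    · rw [charpoly_columnTransfer_succ hd hD, hp, mul_assoc]
    · rcases Polynomial.root_mul.mp hz with hz | hz
      · exact hpr z hz
      · exact norm_root_charpoly_column_sw_lt hd hD hz

theorem spectrum_columnTransfer (h : ℕ) (hh : 1 ≤ h) :
    (((columnTransfer d D 2 h 1).map (algebraMap ℝ ℂ)).charpoly.rootMultiplicity 1 = 1) ∧
    (((columnTransfer d D 2 h 1).map (algebraMap ℝ ℂ)).charpoly.rootMultiplicity
      (subleading d D : ℂ) = 1) ∧
    (∀ z : ℂ, ((columnTransfer d D 2 h 1).map (algebraMap ℝ ℂ)).charpoly.IsRoot z →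
      z = 1 ∨ z = (subleading d D : ℂ) ∨ ‖z‖ < subleading d D) := by
  obtain ⟨h, rfl⟩ := Nat.exists_eq_add_of_le' hh
  obtain ⟨p, hp, hp0, hpr⟩ := exists_charpoly_eq hd hD h
  have hs := subleading_pos hd hD
  have hs1 := subleading_lt_one hd hD
  have hne : (1 : ℂ) ≠ (subleading d D : ℂ) := by exact_mod_cast hs1.ne'
  have n1 : (Polynomial.X - Polynomial.C (1 : ℂ)) *
      (Polynomial.X - Polynomial.C (subleading d D : ℂ)) ≠ 0 :=
    mul_ne_zero (Polynomial.X_sub_C_ne_zero _) (Polynomial.X_sub_C_ne_zero _)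
  have hp1 : p.rootMultiplicity 1 = 0 := Polynomial.rootMultiplicity_eq_zero fun hr => by
    have := hpr 1 hr
    rw [norm_one] at this
    linarith
  have hp2 : p.rootMultiplicity (subleading d D : ℂ) = 0 :=
    Polynomial.rootMultiplicity_eq_zero fun hr => by
      have := hpr _ hr
      rw [Complex.norm_real, Real.norm_of_nonneg hs.le] at this
      exact lt_irrefl _ this
  rw [hp]
  refine ⟨?_, ?_, fun z hz => ?_⟩
  · rw [Polynomial.rootMultiplicity_mul (mul_ne_zero n1 hp0), Polynomial.rootMultiplicity_mul n1,
      Polynomial.rootMultiplicity_X_sub_C, Polynomial.rootMultiplicity_X_sub_C, hp1, if_pos rfl,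
      if_neg hne]
  · rw [Polynomial.rootMultiplicity_mul (mul_ne_zero n1 hp0), Polynomial.rootMultiplicity_mul n1,
      Polynomial.rootMultiplicity_X_sub_C, Polynomial.rootMultiplicity_X_sub_C, hp2, if_pos rfl,
      if_neg hne.symm]
  · rcases Polynomial.root_mul.mp hz with hz | hz
    · rcases Polynomial.root_mul.mp hz with hz | hz
      · left
        exact Polynomial.root_X_sub_C.mp hz |>.symm
      · right; left
        exact Polynomial.root_X_sub_C.mp hz |>.symm
    · exact Or.inr (Or.inr (hpr z hz))

end

end

section

open Asymptotics Filter

/-! ### Perturbed linear recursions -/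

/-- When the contraction is faster than the rate of the error, the error dominates. The constant
below is such that `κ K + C ≤ χ K`. -/
lemma isBigO_of_contracting {n e : ℕ → ℝ} {κ χ : ℝ} (hκ : 0 ≤ κ) (hχ : κ < χ)
    (hn : ∀ r, 0 ≤ n r) (h : ∀ r, n (r + 1) ≤ κ * n r + e r)
    (he : e =O[atTop] fun r : ℕ => χ ^ r) : n =O[atTop] fun r : ℕ => χ ^ r := by
  have hχ0 : 0 < χ := hκ.trans_lt hχ
  obtain ⟨C, hC, hb⟩ := bound_of_isBigO_nat_atTop he
  have hb' : ∀ r, e r ≤ C * χ ^ r := fun r => by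
    have := hb (pow_pos hχ0 r).ne'
    rw [Real.norm_of_nonneg (pow_pos hχ0 r).le] at this
    exact (le_abs_self _).trans this
  refine IsBigO.of_bound (max (n 0) (C / (χ - κ))) (Eventually.of_forall fun r => ?_)
  rw [Real.norm_of_nonneg (hn r), Real.norm_of_nonneg (pow_pos hχ0 r).le]
  induction r with
  | zero => simp
  | succ r ih =>
    set K := max (n 0) (C / (χ - κ)) with hK
    have hCK : C ≤ K * (χ - κ) := (div_le_iff₀ (sub_pos.mpr hχ)).mp (le_max_right _ _)
    have hp := pow_pos hχ0 r
    calc n (r + 1) ≤ κ * n r + e r := h r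
      _ ≤ κ * (K * χ ^ r) + C * χ ^ r := add_le_add (mul_le_mul_of_nonneg_left ih hκ) (hb' r)
      _ ≤ κ * (K * χ ^ r) + K * (χ - κ) * χ ^ r := by gcongr
      _ = K * χ ^ (r + 1) := by ring

/-- When the error decays faster than the mode, the increments of `y r / κ ^ r` are geometric. Its
limit is the amplitude `b`, and the tail gives the error. -/
lemma exists_isBigO_of_recursion {y : ℕ → ℝ} {κ χ : ℝ} (hχ0 : 0 < χ) (hχ : χ < κ)
    (h : (fun r => y (r + 1) - κ * y r) =O[atTop] fun r : ℕ => χ ^ r) :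
    ∃ b, (fun r => y r - b * κ ^ r) =O[atTop] fun r : ℕ => χ ^ r := by
  have hκ : 0 < κ := hχ0.trans hχ
  obtain ⟨C, hC, hb⟩ := bound_of_isBigO_nat_atTop h
  have hd : ∀ r, dist (y r / κ ^ r) (y (r + 1) / κ ^ (r + 1)) ≤ C / κ * (χ / κ) ^ r := by
    intro r
    have := hb (pow_pos hχ0 r).ne'
    rw [Real.norm_of_nonneg (pow_pos hχ0 r).le] at this
    rw [dist_comm, Real.dist_eq]
    have e : y (r + 1) / κ ^ (r + 1) - y r / κ ^ r = (y (r + 1) - κ * y r) / κ ^ (r + 1) := by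
      rw [pow_succ]
      field_simp
    rw [e, abs_div, abs_of_pos (pow_pos hκ _), div_le_iff₀ (pow_pos hκ _)]
    have e2 : C / κ * (χ / κ) ^ r * κ ^ (r + 1) = C * χ ^ r := by
      rw [div_pow, pow_succ]; field_simp
    rw [e2]
    exact this
  have hlt : χ / κ < 1 := (div_lt_one hκ).mpr hχ
  obtain ⟨b, hb⟩ := cauchySeq_tendsto_of_complete (cauchySeq_of_le_geometric _ _ hlt hd)
  refine ⟨b, IsBigO.of_bound (C / κ / (1 - χ / κ)) (Eventually.of_forall fun r => ?_)⟩
  have := dist_le_of_le_geometric_of_tendsto _ _ hlt hd hb r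
  rw [Real.dist_eq] at this
  have e : y r - b * κ ^ r = (y r / κ ^ r - b) * κ ^ r := by field_simp
  rw [e, norm_mul, Real.norm_of_nonneg (pow_pos hκ r).le, Real.norm_of_nonneg (pow_pos hχ0 r).le,
    Real.norm_eq_abs]
  calc _ ≤ C / κ * (χ / κ) ^ r / (1 - χ / κ) * κ ^ r := by gcongr
    _ = C / κ / (1 - χ / κ) * χ ^ r := by rw [div_pow]; field_simp

/-! ### Powers of the transfer matrix -/

/-- The cut with `swap` on its lowest bond only. -/
def lowest (k : ℕ) : Cut (k + 1) := (Fin.cons sw (1 : Cut k) : Cut (k + 1))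

/-- The stationary averaged purity of the lowest bond. -/
def bondPurity (d D : ℕ) : ℝ := wOne d D / (1 - subleading d D)

/-- The right eigenvector of the transfer matrix for the subleading eigenvalue. -/
def subVec (d D k : ℕ) (τ : Cut (k + 1)) : ℝ :=
  Pi.single (M := fun _ => ℝ) (lowest k) 1 τ - bondPurity d D * vac (k + 1) τ

lemma lowest_ne_one (k : ℕ) : lowest k ≠ 1 := by
  intro h
  have := congrFun h 0
  simp [lowest] at this

lemma lowest_zero (τ : Cut 0) : lowest 0 = (Fin.snoc τ sw : Cut 1) := by
  funext i
  fin_cases i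
  simp [lowest, Fin.snoc]

lemma lowest_succ (k : ℕ) : lowest (k + 1) = (Fin.snoc (lowest k) 1 : Cut (k + 2)) := by
  rw [lowest, lowest, one_eq_snoc k]
  exact Fin.cons_snoc_eq_snoc_cons (β := Equiv.Perm (Fin 2)) sw 1 1

lemma subVec_zero_snoc_one (d D : ℕ) (τ : Cut 0) :
    subVec d D 0 (Fin.snoc τ 1 : Cut 1) = - bondPurity d D := by
  have h1 : (Fin.snoc τ 1 : Cut 1) ≠ Fin.snoc τ sw := fun e =>
    one_ne_sw (Fin.snoc_injective2 e).2
  have h2 : τ = 1 := Subsingleton.elim _ _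
  rw [subVec, vac_snoc_one, lowest_zero τ, Pi.single_eq_of_ne h1, h2]
  simp

lemma subVec_zero_snoc_sw (d D : ℕ) (τ : Cut 0) :
    subVec d D 0 (Fin.snoc τ sw : Cut 1) = 1 := by
  rw [subVec, vac_snoc_sw, lowest_zero τ, Pi.single_eq_same]
  simp

lemma subVec_succ_snoc_one (d D k : ℕ) (τ : Cut (k + 1)) :
    subVec d D (k + 1) (Fin.snoc τ 1 : Cut (k + 2)) = subVec d D k τ := by
  have h : (Fin.snoc τ 1 : Cut (k + 2)) = Fin.snoc (lowest k) 1 ↔ τ = lowest k :=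
    ⟨fun e => (Fin.snoc_injective2 e).1, fun e => by rw [e]⟩
  rw [subVec, subVec, vac_snoc_one, lowest_succ]
  simp only [Pi.single_apply, h]

lemma subVec_succ_snoc_sw (d D k : ℕ) (τ : Cut (k + 1)) :
    subVec d D (k + 1) (Fin.snoc τ sw : Cut (k + 2)) = 0 := by
  have h : (Fin.snoc τ sw : Cut (k + 2)) ≠ Fin.snoc (lowest k) 1 := fun e =>
    sw_ne_one (Fin.snoc_injective2 e).2
  rw [subVec, vac_snoc_sw, lowest_succ, Pi.single_eq_of_ne h]
  simp

lemma subVec_lowest (d D k : ℕ) : subVec d D k (lowest k) = 1 := by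
  simp [subVec, lowest_ne_one]

section

variable {d D : ℕ} (hd : 2 ≤ d) (hD : 2 ≤ D)
include hd hD

lemma columnTransfer_mulVec_snoc_one {h : ℕ} (u : Cut (h + 1) → ℝ) (τ : Cut h) :
    (columnTransfer d D 2 (h + 1) 1).mulVec u (Fin.snoc τ 1 : Cut (h + 1)) =
      (columnTransfer d D 2 h 1).mulVec (fun θ => u (Fin.snoc θ 1 : Cut (h + 1))) τ +
      wOne d D * (columnTransfer d D 2 h 1).mulVec
        (fun θ => u (Fin.snoc θ sw : Cut (h + 1))) τ := by
  simp only [Matrix.mulVec, dotProduct]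
  rw [sum_snoc, Finset.mul_sum]
  simp only [columnTransfer_snoc, siteTensor_eq hd hD, columnTransfer_eq_column d D h, if_true,
    sw_ne_one, if_false, mul_one]
  congr 1
  exact Finset.sum_congr rfl fun θ _ => by ring

lemma columnTransfer_mulVec_snoc_sw {h : ℕ} (u : Cut (h + 1) → ℝ) (τ : Cut h) :
    (columnTransfer d D 2 (h + 1) 1).mulVec u (Fin.snoc τ sw : Cut (h + 1)) =
      subleading d D * ∑ θ, column d D (fun _ => 1) sw τ θ * u (Fin.snoc θ sw : Cut (h + 1)) := by
  simp only [Matrix.mulVec, dotProduct]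
  rw [sum_snoc, Finset.mul_sum]
  simp only [columnTransfer_snoc, siteTensor_eq hd hD, if_true,
    sw_ne_one, if_false, mul_zero, zero_mul, Finset.sum_const_zero, zero_add]
  exact Finset.sum_congr rfl fun θ _ => by ring

omit hd hD in
lemma isBigO_mulVec {X : Type*} [Fintype X] (M : Matrix X X ℝ) {u : ℕ → X → ℝ} {g : ℕ → ℝ}
    (h : ∀ θ, (fun r => u r θ) =O[atTop] g) (τ : X) :
    (fun r => M.mulVec (u r) τ) =O[atTop] g := by
  simp only [Matrix.mulVec, dotProduct]
  exact IsBigO.fun_sum fun θ _ => (h θ).const_mul_left _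

/-- Every perturbed trajectory of the transfer matrix is asymptotic to a combination of its two
leading modes. -/
theorem exists_isBigO_trajectory {χ : ℝ} (hχ1 : subleading d D * contraction d D < χ)
    (hχ2 : χ < subleading d D) (k : ℕ) (u : ℕ → Cut (k + 1) → ℝ)
    (hu : ∀ τ, (fun r => u (r + 1) τ - (columnTransfer d D 2 (k + 1) 1).mulVec (u r) τ) =O[atTop]
      fun r : ℕ => χ ^ r) :
    ∃ a b : ℝ, ∀ τ, (fun r => u r τ - a * vac (k + 1) τ - b * subleading d D ^ r * subVec d D k τ)
      =O[atTop] fun r : ℕ => χ ^ r := by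
  have hs := subleading_pos hd hD
  have hs1 := subleading_lt_one hd hD
  have hc := contraction_pos hd hD
  have hχ0 : 0 < χ := (mul_pos hs hc).trans hχ1
  induction k with
  | zero =>
    have τ₀ : Cut 0 := 1
    have hτ : ∀ τ : Cut 0, τ = τ₀ := fun τ => Subsingleton.elim _ _
    have t1 : columnTransfer d D 2 0 1 τ₀ τ₀ = 1 := by simp [columnTransfer]
    have t2 : column d D (fun _ => 1) sw τ₀ τ₀ = 1 := by simp [column]
    have h1 := hu (Fin.snoc τ₀ 1 : Cut 1)
    have h2 := hu (Fin.snoc τ₀ sw : Cut 1)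
    simp only [columnTransfer_mulVec_snoc_one hd hD, columnTransfer_mulVec_snoc_sw hd hD] at h1 h2
    simp only [Matrix.mulVec, dotProduct, Fintype.sum_subsingleton _ τ₀, t1, t2, one_mul] at h1 h2
    obtain ⟨b, hb⟩ := exists_isBigO_of_recursion
      (y := fun r => u r (Fin.snoc τ₀ sw : Cut 1)) hχ0 hχ2 h2
    -- Adding `bondPurity` times the second component diagonalizes the triangular 2 by 2 recursion
    -- and isolates the mode with eigenvalue 1.
    have h3 : (fun r => (u (r + 1) (Fin.snoc τ₀ 1 : Cut 1) +
        bondPurity d D * u (r + 1) (Fin.snoc τ₀ sw : Cut 1)) -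
        1 * (u r (Fin.snoc τ₀ 1 : Cut 1) + bondPurity d D * u r (Fin.snoc τ₀ sw : Cut 1)))
        =O[atTop] fun r : ℕ => χ ^ r := by
      refine (h1.add (h2.const_mul_left (bondPurity d D))).congr_left fun r => ?_
      have : wOne d D = bondPurity d D * (1 - subleading d D) := by
        rw [bondPurity, div_mul_cancel₀ _ (sub_ne_zero.mpr hs1.ne')]
      rw [this]
      ring
    obtain ⟨a, ha⟩ := exists_isBigO_of_recursion (y := fun r => u r (Fin.snoc τ₀ 1 : Cut 1) +
      bondPurity d D * u r (Fin.snoc τ₀ sw : Cut 1)) hχ0 (hχ2.trans hs1) h3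
    refine ⟨a, b, fun τ => ?_⟩
    refine snoc_cases (p := fun τ => (fun r => u r τ - a * vac (0 + 1) τ -
      b * subleading d D ^ r * subVec d D 0 τ) =O[atTop] fun r : ℕ => χ ^ r)
      (fun τ => ?_) (fun τ => ?_) τ
    · rw [hτ τ, vac_snoc_one, subVec_zero_snoc_one]
      have : vac 0 τ₀ = 1 := by rw [← hτ 1]; exact Pi.single_eq_same _ _
      rw [this]
      refine (ha.sub (hb.const_mul_left (bondPurity d D))).congr_left fun r => ?_
      simp only [one_pow]
      ring
    · rw [hτ τ, vac_snoc_sw, subVec_zero_snoc_sw]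
      exact hb.congr_left fun r => by ring
  | succ k ih =>
    -- The components with top spin `sw` evolve on their own and contract at rate `λ₂ * contraction
    -- < χ`. They therefore only perturb the components with top spin `1`, to which the induction
    -- hypothesis applies; this is why the theorem allows perturbations.
    have h2 : ∀ τ : Cut (k + 1), (fun r => u r (Fin.snoc τ sw : Cut (k + 2))) =O[atTop]
        fun r : ℕ => χ ^ r := by
      have hn : (fun r => ∑ τ : Cut (k + 1), ‖u r (Fin.snoc τ sw : Cut (k + 2))‖) =O[atTop]
          fun r : ℕ => χ ^ r := by
        refine isBigO_of_contracting (e := fun r => ∑ τ : Cut (k + 1),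
          ‖u (r + 1) (Fin.snoc τ sw : Cut (k + 2)) -
            (columnTransfer d D 2 (k + 2) 1).mulVec (u r) (Fin.snoc τ sw : Cut (k + 2))‖)
          (mul_pos hs hc).le hχ1 (fun r => Finset.sum_nonneg fun _ _ => norm_nonneg _)
          (fun r => ?_) (IsBigO.fun_sum fun τ _ => (hu _).norm_left)
        have hB := sum_norm_column_sw_le (E := ℝ) hd hD
          (fun τ : Cut (k + 1) => u r (Fin.snoc τ sw : Cut (k + 2)))
        calc ∑ τ : Cut (k + 1), ‖u (r + 1) (Fin.snoc τ sw : Cut (k + 2))‖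
            ≤ ∑ τ : Cut (k + 1), (subleading d D * ‖∑ θ, algebraMap ℝ ℝ
                (column d D (fun _ => 1) sw τ θ) * u r (Fin.snoc θ sw : Cut (k + 2))‖ +
              ‖u (r + 1) (Fin.snoc τ sw : Cut (k + 2)) -
              (columnTransfer d D 2 (k + 2) 1).mulVec (u r) (Fin.snoc τ sw : Cut (k + 2))‖) := by
              refine Finset.sum_le_sum fun τ _ => ?_
              rw [columnTransfer_mulVec_snoc_sw hd hD]
              refine (norm_le_norm_add_norm_sub' _ _).trans (add_le_add (le_of_eq ?_) le_rfl)
              rw [norm_mul, Real.norm_of_nonneg hs.le]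
              rfl
          _ ≤ _ := by
              rw [Finset.sum_add_distrib, ← Finset.mul_sum, mul_assoc]
              exact add_le_add (mul_le_mul_of_nonneg_left hB hs.le) le_rfl
      intro τ
      refine (IsBigO.of_bound 1 (Eventually.of_forall fun r => ?_)).trans hn
      rw [one_mul, Real.norm_of_nonneg (Finset.sum_nonneg fun _ _ => norm_nonneg _)]
      exact Finset.single_le_sum (f := fun τ : Cut (k + 1) =>
        ‖u r (Fin.snoc τ sw : Cut (k + 2))‖) (fun _ _ => norm_nonneg _) (Finset.mem_univ τ)
    obtain ⟨a, b, hab⟩ := ih (fun r τ => u r (Fin.snoc τ 1 : Cut (k + 2))) fun τ => by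
      have h1 := hu (Fin.snoc τ 1 : Cut (k + 2))
      simp only [columnTransfer_mulVec_snoc_one hd hD] at h1
      refine (h1.add ((isBigO_mulVec (columnTransfer d D 2 (k + 1) 1) h2 τ).const_mul_left
        (wOne d D))).congr_left fun r => ?_
      ring
    refine ⟨a, b, fun τ => ?_⟩
    refine snoc_cases (p := fun τ => (fun r => u r τ - a * vac (k + 1 + 1) τ -
      b * subleading d D ^ r * subVec d D (k + 1) τ) =O[atTop] fun r : ℕ => χ ^ r)
      (fun τ => ?_) (fun τ => ?_) τ
    · rw [vac_snoc_one, subVec_succ_snoc_one]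
      exact hab τ
    · rw [vac_snoc_sw, subVec_succ_snoc_sw]
      exact (h2 τ).congr_left fun r => by ring

end

end

section

open Asymptotics Filter Topology

/-! ### The lowest row -/

lemma sum_cons {k : ℕ} (F : Cut (k + 1) → ℝ) :
    ∑ τ, F τ = ∑ τ : Cut k, (F (Fin.cons 1 τ : Cut (k + 1)) + F (Fin.cons sw τ : Cut (k + 1))) := by
  rw [← (Fin.consEquiv (fun _ => Equiv.Perm (Fin 2))).sum_comp, Fintype.sum_prod_type,
    sum_perm_two, Finset.sum_add_distrib]
  rfl

/-- The permutation on the upper leg of the lowest site of a column, where `τ` is the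
configuration of the other sites and `ν` the permutation above the column. -/
def above {k : ℕ} (τ : Cut k) (ν : Equiv.Perm (Fin 2)) : Equiv.Perm (Fin 2) :=
  if h : 0 < k then τ ⟨0, h⟩ else ν

lemma column_cons (d D : ℕ) {k : ℕ} (ρ : Cut (k + 1)) (ν x y : Equiv.Perm (Fin 2)) (τ θ : Cut k) :
    column d D ρ ν (Fin.cons x τ : Cut (k + 1)) (Fin.cons y θ : Cut (k + 1)) =
      siteTensor d D (ρ 0) x y (above τ ν) * column d D (fun i => ρ i.succ) ν τ θ := by
  simp only [column, Matrix.of_apply]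
  rw [Fin.prod_univ_succ]
  refine congrArg₂ (fun a b : ℝ => a * b) ?_ (Finset.prod_congr rfl fun i _ => ?_)
  · rw [Fin.cons_zero, Fin.cons_zero]
    refine congrArg (siteTensor d D (ρ 0) x y) ?_
    by_cases h : 0 < k
    · rw [above, dif_pos h, dif_pos (by simpa using h)]
      exact Fin.cons_succ (α := fun _ => Equiv.Perm (Fin 2)) x τ ⟨0, h⟩
    · rw [above, dif_neg h, dif_neg (by simpa using h)]
  · rw [Fin.cons_succ, Fin.cons_succ]
    refine congrArg (siteTensor d D (ρ i.succ) (τ i) (θ i)) ?_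
    by_cases h : i.val + 1 < k
    · rw [dif_pos h, dif_pos (by simpa using h)]
      exact Fin.cons_succ (α := fun _ => Equiv.Perm (Fin 2)) x τ ⟨i.val + 1, h⟩
    · rw [dif_neg h, dif_neg (by simpa using h)]

lemma one_eq_cons (k : ℕ) : (1 : Cut (k + 1)) = (Fin.cons 1 (1 : Cut k) : Cut (k + 1)) := by
  funext i
  induction i using Fin.cases with
  | zero => simp
  | succ i => simp

section

variable {d D : ℕ} (hd : 2 ≤ d) (hD : 2 ≤ D)

lemma exists_shift (hd : 2 ≤ d) (hD : 2 ≤ D) :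
    ∃ x y : ℝ, 0 ≤ x ∧ 0 ≤ y ∧ (d : ℝ) = x + 2 ∧ (D : ℝ) = y + 2 := by
  have h1 : (2 : ℝ) ≤ d := by exact_mod_cast hd
  have h2 : (2 : ℝ) ≤ D := by exact_mod_cast hD
  exact ⟨d - 2, D - 2, by linarith, by linarith, by ring, by ring⟩

include hd hD

/-- This is the local form of the invariance of the cone `IsTame`. The claim is linear in `(p, s)`,
so it suffices to check the extremal rays `(0, 1)` and `(D, 1)`. -/
lemma siteTensor_bond (ρ ν : Equiv.Perm (Fin 2)) {p s : ℝ} (hp : 0 ≤ p) (hps : p ≤ D * s) :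
    p * siteTensor d D ρ 1 1 ν + s * siteTensor d D ρ sw 1 ν ≤
      D * (p * siteTensor d D ρ 1 sw ν + s * siteTensor d D ρ sw sw ν) := by
  have hN := denom_pos hd hD
  -- After substituting `d = x + 2` and `D = y + 2`, the required polynomials expand with
  -- nonnegative coefficients.
  obtain ⟨x, y, hx, hy, ex, ey⟩ := exists_shift hd hD
  have hD0 : (0 : ℝ) < D := by rw [ey]; linarith
  obtain ⟨z, hz, rfl⟩ : ∃ z, 0 ≤ z ∧ s = p / D + z :=
    ⟨s - p / D, by rw [sub_nonneg, div_le_iff₀ hD0]; linarith, by ring⟩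
  have key : ∀ A B : ℝ, 0 ≤ B → 0 ≤ A * D + B →
      0 ≤ p * A + (p / D + z) * B := by
    intro A B hB hAB
    have : p * A + (p / D + z) * B = p / D * (A * D + B) + z * B := by field_simp; ring
    rw [this]
    positivity
  have k2 := key (D * siteTensor d D ρ 1 sw ν - siteTensor d D ρ 1 1 ν)
    (D * siteTensor d D ρ sw sw ν - siteTensor d D ρ sw 1 ν) ?_ ?_
  · linarith
  · rw [siteTensor_eq hd hD, siteTensor_eq hd hD]
    rcases perm_two_cases ρ with rfl | rfl <;> rcases perm_two_cases ν with rfl | rfl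
    · simp
      have := subleading_pos hd hD
      positivity
    · simp only [sw_ne_one, if_true, if_false]
      rw [wAll, subleading, ← mul_div_assoc, ← sub_div]
      refine div_nonneg ?_ hN.le
      rw [ex, ey]; ring_nf; positivity
    · simp only [one_ne_sw, if_true, if_false]
      rw [wOne, wTwo, ← mul_div_assoc, ← sub_div]
      refine div_nonneg ?_ hN.le
      rw [ex, ey]; ring_nf; positivity
    · simp only [one_ne_sw, if_true, if_false]
      rw [wOne, mul_one, sub_nonneg, div_le_iff₀ hN, ← sub_nonneg]
      rw [ex, ey]; ring_nf; positivity
  · have hq : 0 ≤ ((D : ℝ) ^ 2 - 1) * (d * D - 1) := by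
      rw [ex, ey]; ring_nf; positivity
    have hd0 : (0 : ℝ) < d := by rw [ex]; linarith
    obtain ⟨c, hc, hc'⟩ : ∃ c : ℝ, 0 ≤ c ∧
        (D * siteTensor d D ρ 1 sw ν - siteTensor d D ρ 1 1 ν) * D +
        (D * siteTensor d D ρ sw sw ν - siteTensor d D ρ sw 1 ν) =
        c * (((D : ℝ) ^ 2 - 1) * (d * D - 1)) / ((d : ℝ) ^ 2 * (D : ℝ) ^ 4 - 1) := by
      rw [siteTensor_eq hd hD, siteTensor_eq hd hD, siteTensor_eq hd hD, siteTensor_eq hd hD]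
      obtain ⟨N, hNe⟩ : ∃ N : ℝ, N = (d : ℝ) ^ 2 * (D : ℝ) ^ 4 - 1 := ⟨_, rfl⟩
      have hN' : N ≠ 0 := hNe ▸ hN.ne'
      rcases perm_two_cases ρ with rfl | rfl <;> rcases perm_two_cases ν with rfl | rfl <;>
      simp only [one_ne_sw, sw_ne_one, if_true, if_false, wOne, wTwo, wAll, subleading, ← hNe]
      · exact ⟨D, by positivity, by field_simp; rw [hNe]; ring⟩
      · exact ⟨D ^ 2, by positivity, by field_simp; ring⟩
      · exact ⟨d * D, by positivity, by field_simp; ring⟩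
      · exact ⟨d * D ^ 2, by positivity, by field_simp; rw [hNe]; ring⟩
    rw [hc']
    exact div_nonneg (mul_nonneg hc hq) hN.le

/-- The two components of the lowest-row factor of `S subVec` are tested on the rays `(0, 1)` and
`(D, 1)` of the cone; the component at `1` alone need not be positive. -/
lemma bondPurity_bounds (ν : Equiv.Perm (Fin 2)) :
    0 < siteTensor d D sw sw sw ν - bondPurity d D * siteTensor d D sw sw 1 ν ∧
    0 < (siteTensor d D sw sw sw ν - bondPurity d D * siteTensor d D sw sw 1 ν) +
      D * (siteTensor d D sw 1 sw ν - bondPurity d D * siteTensor d D sw 1 1 ν) := by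
  have hN := denom_pos hd hD
  have h1 := subleading_lt_one hd hD
  obtain ⟨N, hNe⟩ : ∃ N : ℝ, N = (d : ℝ) ^ 2 * (D : ℝ) ^ 4 - 1 := ⟨_, rfl⟩
  obtain ⟨a, ha⟩ : ∃ a : ℝ, a = (d : ℝ) ^ 2 * (D : ℝ) ^ 3 - D := ⟨_, rfl⟩
  obtain ⟨b, hb⟩ : ∃ b : ℝ, b = (d : ℝ) ^ 2 * (D : ℝ) ^ 2 - (D : ℝ) ^ 2 := ⟨_, rfl⟩
  obtain ⟨l, hl⟩ : ∃ l : ℝ, l = (d : ℝ) * (D : ℝ) ^ 3 - d * D := ⟨_, rfl⟩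
  obtain ⟨c, hc⟩ : ∃ c : ℝ, c = (d : ℝ) * (D : ℝ) ^ 4 - d := ⟨_, rfl⟩
  obtain ⟨x, y, hx, hy, ex, ey⟩ := exists_shift hd hD
  rw [siteTensor_eq hd hD, siteTensor_eq hd hD, siteTensor_eq hd hD, siteTensor_eq hd hD]
  simp only [bondPurity, wOne, wTwo, wAll, subleading, ← hNe, ← ha, ← hb, ← hl, ← hc] at h1 hN ⊢
  -- With `M = N - l`, `bondPurity` is `a / M`, and each claim becomes positivity of a polynomial
  -- numerator over a power product of `N` and `M`.
  obtain ⟨M, hMe⟩ : ∃ M : ℝ, M = N - l := ⟨_, rfl⟩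
  have hM : 0 < M := by
    rw [div_lt_one hN] at h1
    linarith
  have ht : a / N / (1 - l / N) = a / M := by
    rw [hMe]
    field_simp
  have hfrac : ∀ {e num : ℝ}, 0 < num → e = num / (N * M) → 0 < e :=
    fun h e => e ▸ div_pos h (mul_pos hN hM)
  rw [ht]
  rcases perm_two_cases ν with rfl | rfl <;> simp only [one_ne_sw, if_true, if_false]
  · constructor
    · refine hfrac (num := a * (M - b)) ?_ (by field_simp)
      rw [hMe, hNe, ha, hb, hl, ex, ey]; ring_nf; positivity
    · refine hfrac (num := (a + D * l) * M - a * (b + D * c)) ?_ (by field_simp; ring)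
      rw [hMe, hNe, ha, hb, hl, hc, ex, ey]; ring_nf; positivity
  · constructor
    · refine hfrac (num := N * M - a ^ 2) ?_ (by field_simp)
      rw [hMe, hNe, ha, hl, ex, ey]; ring_nf; positivity
    · refine hfrac (num := N * M - a ^ 2 - D * a * l) ?_ (by field_simp; ring)
      rw [hMe, hNe, ha, hl, ex, ey]; ring_nf; positivity

end

end

/-! ### An invariant cone of row vectors and its pairing with the subleading mode -/

section

open Asymptotics Filter Topology

/-- Nonnegative row vectors for which an additional `swap` on the lowest bond costs at most a
factor `D`. -/
structure IsTame (D : ℕ) {k : ℕ} (F : Cut (k + 1) → ℝ) : Prop where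
  nonneg : ∀ τ, 0 ≤ F τ
  one_pos : 0 < F 1
  bond : ∀ τ : Cut k, F (Fin.cons 1 τ : Cut (k + 1)) ≤ D * F (Fin.cons sw τ : Cut (k + 1))

section

variable {d D : ℕ} (hd : 2 ≤ d) (hD : 2 ≤ D)
include hd hD

lemma columnTransfer_nonneg {h : ℕ} (ρ : Equiv.Perm (Fin 2)) (τ θ : Cut h) :
    0 ≤ columnTransfer d D 2 h ρ τ θ := by
  rw [columnTransfer_eq_column]
  exact column_nonneg hd hD _ _ _ _

lemma column_sw_one_pos {h : ℕ} (ν : Equiv.Perm (Fin 2)) (τ : Cut h) :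
    0 < column d D (fun _ => sw) ν τ 1 := by
  rw [column, Matrix.of_apply]
  refine Finset.prod_pos fun i _ => ?_
  have := wOne_pos hd hD
  have := wTwo_pos hd hD
  have := wAll_pos hd hD
  have := subleading_pos hd hD
  rw [siteTensor_eq hd hD, Pi.one_apply]
  simp only [one_ne_sw, if_false]
  split_ifs <;> assumption

lemma columnTransfer_one_one_pos (h : ℕ) (ρ : Equiv.Perm (Fin 2)) :
    0 < columnTransfer d D 2 h ρ 1 1 := by
  rcases perm_two_cases ρ with rfl | rfl
  · rw [columnTransfer_apply_one hd hD]
    simp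
  · rw [columnTransfer_eq_column]
    exact column_sw_one_pos hd hD _ _

lemma columnTransfer_lowest (k : ℕ) :
    columnTransfer d D 2 (k + 1) 1 (lowest k) (lowest k) = subleading d D := by
  rw [columnTransfer_eq_column, lowest, column_cons]
  have h1 : above (1 : Cut k) 1 = 1 := by
    unfold above
    split_ifs <;> rfl
  have h2 : column d D (fun _ : Fin k => 1) 1 1 1 = 1 := by
    rw [← columnTransfer_eq_column, columnTransfer_apply_one hd hD]
    simp
  rw [h1, h2, siteTensor_eq hd hD]
  simp

omit hd in
lemma isTame_one (k : ℕ) : IsTame D (1 : Cut (k + 1) → ℝ) where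
  nonneg _ := zero_le_one
  one_pos := zero_lt_one
  bond _ := by
    simp only [Pi.one_apply, mul_one]
    exact_mod_cast (by omega : 1 ≤ D)

/-- For a fixed configuration of the rows above the lowest one, the bond inequality is
`siteTensor_bond` times a nonnegative weight. -/
lemma IsTame.vecMul {k : ℕ} {F : Cut (k + 1) → ℝ} (hF : IsTame D F) (ρ : Equiv.Perm (Fin 2)) :
    IsTame D (Matrix.vecMul F (columnTransfer d D 2 (k + 1) ρ)) where
  nonneg τ := Finset.sum_nonneg fun θ _ =>
    mul_nonneg (hF.nonneg θ) (columnTransfer_nonneg hd hD _ _ _)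
  one_pos := Finset.sum_pos' (fun θ _ => mul_nonneg (hF.nonneg θ)
    (columnTransfer_nonneg hd hD _ _ _)) ⟨1, Finset.mem_univ _,
      mul_pos hF.one_pos (columnTransfer_one_one_pos hd hD _ _)⟩
  bond τ := by
    simp only [Matrix.vecMul, dotProduct]
    rw [sum_cons, sum_cons, Finset.mul_sum]
    refine Finset.sum_le_sum fun θ _ => ?_
    simp only [columnTransfer_eq_column, column_cons]
    have h := mul_le_mul_of_nonneg_right
      (siteTensor_bond hd hD ρ (above θ 1) (hF.nonneg _) (hF.bond θ))
      (column_nonneg hd hD (fun _ : Fin k => ρ) 1 θ τ)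
    linarith

lemma IsTame.vecMul_pow {k : ℕ} {F : Cut (k + 1) → ℝ} (hF : IsTame D F)
    (ρ : Equiv.Perm (Fin 2)) (n : ℕ) :
    IsTame D (Matrix.vecMul F (columnTransfer d D 2 (k + 1) ρ ^ n)) := by
  induction n with
  | zero => simpa using hF
  | succ n ih =>
    rw [pow_succ, ← Matrix.vecMul_vecMul]
    exact ih.vecMul hd hD ρ

/-- Both terms of `subVec` have `1` on every bond above the lowest, so in `S subVec` the upper rows
form a common positive factor. What remains is a pairing on the lowest row, controlled by the cone.
-/
lemma IsTame.dotProduct_pos {k : ℕ} {F : Cut (k + 1) → ℝ} (hF : IsTame D F) :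
    0 < F ⬝ᵥ (columnTransfer d D 2 (k + 1) sw).mulVec (subVec d D k) := by
  have hS : ∀ (x : Equiv.Perm (Fin 2)) (τ : Cut k),
      (columnTransfer d D 2 (k + 1) sw).mulVec (subVec d D k) (Fin.cons x τ : Cut (k + 1)) =
      (siteTensor d D sw x sw (above τ 1) -
        bondPurity d D * siteTensor d D sw x 1 (above τ 1)) *
        column d D (fun _ => sw) 1 τ 1 := by
    intro x τ
    have h1 : subVec d D k = Pi.single (lowest k) 1 - bondPurity d D • vac (k + 1) := by
      funext τ
      simp [subVec]
    rw [h1, Matrix.mulVec_sub, Matrix.mulVec_smul, Matrix.mulVec_single_one,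
      Matrix.mulVec_single_one]
    simp only [Pi.sub_apply, Pi.smul_apply, smul_eq_mul, Matrix.col_apply,
      columnTransfer_eq_column]
    rw [one_eq_cons, lowest, column_cons, column_cons]
    ring
  have hD0 : (0 : ℝ) < D := by exact_mod_cast (by omega : 0 < D)
  have hterm : ∀ τ : Cut k, 0 ≤ F (Fin.cons sw τ : Cut (k + 1)) ∧
      ∀ e : ℝ, 0 ≤ e → e ≤ D * F (Fin.cons sw τ : Cut (k + 1)) →
      (0 ≤ e * (siteTensor d D sw 1 sw (above τ 1) -
        bondPurity d D * siteTensor d D sw 1 1 (above τ 1)) +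
        F (Fin.cons sw τ : Cut (k + 1)) * (siteTensor d D sw sw sw (above τ 1) -
        bondPurity d D * siteTensor d D sw sw 1 (above τ 1)) ∧
      (0 < F (Fin.cons sw τ : Cut (k + 1)) →
        0 < e * (siteTensor d D sw 1 sw (above τ 1) -
        bondPurity d D * siteTensor d D sw 1 1 (above τ 1)) +
        F (Fin.cons sw τ : Cut (k + 1)) * (siteTensor d D sw sw sw (above τ 1) -
        bondPurity d D * siteTensor d D sw sw 1 (above τ 1)))) := by
    intro τ
    obtain ⟨b1, b2⟩ := bondPurity_bounds hd hD (above τ 1)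
    generalize siteTensor d D sw sw sw (above τ 1) -
        bondPurity d D * siteTensor d D sw sw 1 (above τ 1) = p at *
    generalize siteTensor d D sw 1 sw (above τ 1) -
        bondPurity d D * siteTensor d D sw 1 1 (above τ 1) = q at *
    refine ⟨hF.nonneg _, fun e he hle => ?_⟩
    generalize F (Fin.cons sw τ : Cut (k + 1)) = s at *
    -- The minimum over `0 ≤ e ≤ D s` is attained at `e = 0` or at `e = D s`, according to the sign
    -- of `q`.
    have key : ∃ ε > 0, ε * s ≤ e * q + s * p := by
      have hs : 0 ≤ s := by
        by_contra hs
        have := mul_neg_of_pos_of_neg hD0 (not_le.mp hs)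
        linarith
      rcases le_total 0 q with hq | hq
      · exact ⟨p, b1, by nlinarith [mul_nonneg he hq]⟩
      · exact ⟨p + D * q, b2, by nlinarith [mul_le_mul_of_nonpos_right hle hq]⟩
    obtain ⟨ε, hε, hk⟩ := key
    have hs : 0 ≤ s := by
      by_contra hs
      have := mul_neg_of_pos_of_neg hD0 (not_le.mp hs)
      linarith
    exact ⟨(mul_nonneg hε.le hs).trans hk, fun h => (mul_pos hε h).trans_le hk⟩
  simp only [dotProduct]
  rw [sum_cons]
  have hsum : ∀ τ : Cut k, F (Fin.cons 1 τ : Cut (k + 1)) *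
      (columnTransfer d D 2 (k + 1) sw).mulVec (subVec d D k) (Fin.cons 1 τ : Cut (k + 1)) +
      F (Fin.cons sw τ : Cut (k + 1)) *
      (columnTransfer d D 2 (k + 1) sw).mulVec (subVec d D k) (Fin.cons sw τ : Cut (k + 1)) =
      (F (Fin.cons 1 τ : Cut (k + 1)) * (siteTensor d D sw 1 sw (above τ 1) -
        bondPurity d D * siteTensor d D sw 1 1 (above τ 1)) +
        F (Fin.cons sw τ : Cut (k + 1)) * (siteTensor d D sw sw sw (above τ 1) -
        bondPurity d D * siteTensor d D sw sw 1 (above τ 1))) *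
        column d D (fun _ => sw) 1 τ 1 := by
    intro τ
    rw [hS, hS]
    ring
  simp_rw [hsum]
  refine Finset.sum_pos' (fun τ _ => mul_nonneg
    ((hterm τ).2 _ (hF.nonneg _) (hF.bond τ)).1 (column_nonneg hd hD _ _ _ _))
    ⟨1, Finset.mem_univ _, mul_pos (((hterm 1).2 _ (hF.nonneg _) (hF.bond 1)).2 ?_)
      (column_sw_one_pos hd hD _ _)⟩
  have h1 := hF.one_pos
  rw [one_eq_cons] at h1
  exact pos_of_mul_pos_right (h1.trans_le (hF.bond 1)) hD0.le

/-! ### The stationary row vector -/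

/-- The bound `λ₂ ^ 2 ≤ χ` lets the error absorb the quadratic term of the logarithm. -/
lemma exists_rate : ∃ χ : ℝ, subleading d D * contraction d D < χ ∧ χ < subleading d D ∧
    subleading d D ^ 2 ≤ χ := by
  have hs := subleading_pos hd hD
  have hs1 := subleading_lt_one hd hD
  have hc1 := contraction_lt_one hd hD
  have h1 : subleading d D * contraction d D < subleading d D := by nlinarith
  have h2 : subleading d D ^ 2 < subleading d D := by nlinarith
  have h3 := max_lt h1 h2
  exact ⟨(max (subleading d D * contraction d D) (subleading d D ^ 2) + subleading d D) / 2,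
    by linarith [le_max_left (subleading d D * contraction d D) (subleading d D ^ 2)],
    by linarith, by linarith [le_max_right (subleading d D * contraction d D) (subleading d D ^ 2)]⟩

lemma exists_isBigO_pow {χ : ℝ} (hχ1 : subleading d D * contraction d D < χ)
    (hχ2 : χ < subleading d D) (k : ℕ) (u : Cut (k + 1) → ℝ) :
    ∃ a b : ℝ, ∀ τ, (fun r : ℕ => (columnTransfer d D 2 (k + 1) 1 ^ r).mulVec u τ -
      a * vac (k + 1) τ - b * subleading d D ^ r * subVec d D k τ)
      =O[atTop] fun r : ℕ => χ ^ r := by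
  refine exists_isBigO_trajectory hd hD hχ1 hχ2 k
    (fun r => (columnTransfer d D 2 (k + 1) 1 ^ r).mulVec u) fun τ => ?_
  refine (isBigO_zero (fun r : ℕ => χ ^ r) atTop).congr_left fun r => ?_
  rw [pow_succ', Matrix.mulVec_mulVec, sub_self]

/-- The pairing with the all-ones vector sums the entries of `T ^ c u`. Only the `vac` mode
survives, and its entries sum to 1. This identifies the leading coefficient with `ℓ ⬝ u`. -/
lemma tendsto_of_isBigO_pow {χ : ℝ} (hχ1 : subleading d D * contraction d D < χ)
    (hχ2 : χ < subleading d D) {k : ℕ} {u : Cut (k + 1) → ℝ} {a b : ℝ}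
    (h : ∀ τ, (fun r : ℕ => (columnTransfer d D 2 (k + 1) 1 ^ r).mulVec u τ -
      a * vac (k + 1) τ - b * subleading d D ^ r * subVec d D k τ)
      =O[atTop] fun r : ℕ => χ ^ r) :
    Tendsto (fun c : ℕ => Matrix.vecMul 1 (columnTransfer d D 2 (k + 1) 1 ^ c) ⬝ᵥ u) atTop
      (𝓝 a) := by
  have hs := subleading_pos hd hD
  have hs1 := subleading_lt_one hd hD
  have hχ0 : 0 < χ := (mul_pos hs (contraction_pos hd hD)).trans hχ1
  have h1 : ∀ τ, Tendsto (fun r : ℕ => (columnTransfer d D 2 (k + 1) 1 ^ r).mulVec u τ) atTop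
      (𝓝 (a * vac (k + 1) τ)) := by
    intro τ
    have e1 : Tendsto (fun r : ℕ => (columnTransfer d D 2 (k + 1) 1 ^ r).mulVec u τ -
        a * vac (k + 1) τ - b * subleading d D ^ r * subVec d D k τ) atTop (𝓝 0) :=
      (h τ).trans_tendsto (tendsto_pow_atTop_nhds_zero_of_lt_one hχ0.le (hχ2.trans hs1))
    have e2 : Tendsto (fun r : ℕ => b * subleading d D ^ r * subVec d D k τ) atTop
        (𝓝 (b * 0 * subVec d D k τ)) :=
      ((tendsto_pow_atTop_nhds_zero_of_lt_one hs.le hs1).const_mul b).mul_const _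
    have e3 := (e1.add e2).add_const (a * vac (k + 1) τ)
    simp only [mul_zero, zero_mul, add_zero, zero_add] at e3
    exact e3.congr fun r => by ring
  have h2 := tendsto_finsetSum Finset.univ fun τ _ => h1 τ
  have h3 : ∑ τ, a * vac (k + 1) τ = a := by
    rw [← Finset.mul_sum]
    simp
  rw [h3] at h2
  refine h2.congr fun c => ?_
  rw [← Matrix.dotProduct_mulVec, one_dotProduct]

/-- The stationary row vector of the transfer matrix. -/
theorem exists_stationary (k : ℕ) : ∃ ℓ : Cut (k + 1) → ℝ, IsTame D ℓ ∧
    ∀ u : Cut (k + 1) → ℝ, Tendsto (fun c : ℕ =>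
      Matrix.vecMul 1 (columnTransfer d D 2 (k + 1) 1 ^ c) ⬝ᵥ u) atTop (𝓝 (ℓ ⬝ᵥ u)) := by
  obtain ⟨χ, hχ1, hχ2, -⟩ := exists_rate hd hD
  choose ℓ b hℓ using fun θ : Cut (k + 1) => exists_isBigO_pow hd hD hχ1 hχ2 k (Pi.single θ 1)
  have hlim : ∀ θ, Tendsto (fun c : ℕ =>
      Matrix.vecMul 1 (columnTransfer d D 2 (k + 1) 1 ^ c) θ) atTop (𝓝 (ℓ θ)) := by
    intro θ
    have := tendsto_of_isBigO_pow hd hD hχ1 hχ2 (hℓ θ)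
    simpa only [dotProduct_single_one] using this
  have htame := fun c => (isTame_one hD k).vecMul_pow hd hD 1 c
  refine ⟨ℓ, ⟨fun τ => ge_of_tendsto' (hlim τ) fun c => (htame c).nonneg τ, ?_, fun τ =>
    le_of_tendsto_of_tendsto' (hlim _) ((hlim _).const_mul _) fun c => (htame c).bond τ⟩,
    fun u => ?_⟩
  -- Strict positivity does not pass to limits in general, but the entry at `1` is constant because
  -- `T` fixes `vac`.
  · have h1 : ∀ c : ℕ, Matrix.vecMul 1 (columnTransfer d D 2 (k + 1) 1 ^ c) 1 = (1 : ℝ) := by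
      intro c
      rw [← dotProduct_single_one (Matrix.vecMul 1 (columnTransfer d D 2 (k + 1) 1 ^ c)) 1,
        ← Matrix.dotProduct_mulVec, columnTransfer_pow_mulVec_vac hd hD]
      simp
    have h2 := hlim 1
    simp only [h1] at h2
    rw [← tendsto_nhds_unique tendsto_const_nhds h2]
    exact one_pos
  · exact tendsto_finsetSum _ fun θ _ => (hlim θ).mul_const _

omit hd hD in
lemma IsTame.dotProduct_pos_of_nonneg {k : ℕ} {F u : Cut (k + 1) → ℝ} (hF : IsTame D F)
    (hu : ∀ τ, 0 ≤ u τ) (hu1 : 0 < u 1) : 0 < F ⬝ᵥ u :=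
  Finset.sum_pos' (fun τ _ => mul_nonneg (hF.nonneg τ) (hu τ))
    ⟨1, Finset.mem_univ _, mul_pos hF.one_pos hu1⟩

lemma mulVec_nonneg {h : ℕ} (ρ : Equiv.Perm (Fin 2)) {u : Cut h → ℝ} (hu : ∀ τ, 0 ≤ u τ)
    (n : ℕ) (τ : Cut h) : 0 ≤ (columnTransfer d D 2 h ρ ^ n).mulVec u τ := by
  induction n generalizing τ with
  | zero => simpa using hu τ
  | succ n ih =>
    rw [pow_succ', ← Matrix.mulVec_mulVec]
    exact Finset.sum_nonneg fun θ _ => mul_nonneg (columnTransfer_nonneg hd hD _ _ _) (ih θ)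

lemma mulVec_one_pos {h : ℕ} (ρ : Equiv.Perm (Fin 2)) {u : Cut h → ℝ} (hu : ∀ τ, 0 ≤ u τ)
    (hu1 : 0 < u 1) (n : ℕ) : 0 < (columnTransfer d D 2 h ρ ^ n).mulVec u 1 := by
  induction n with
  | zero => simpa using hu1
  | succ n ih =>
    rw [pow_succ', ← Matrix.mulVec_mulVec]
    exact Finset.sum_pos' (fun θ _ => mul_nonneg (columnTransfer_nonneg hd hD _ _ _)
      (mulVec_nonneg hd hD ρ hu n θ))
      ⟨1, Finset.mem_univ _, mul_pos (columnTransfer_one_one_pos hd hD _ _) ih⟩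

lemma mulVec_sw_pos {h : ℕ} {u : Cut h → ℝ} (hu : ∀ τ, 0 ≤ u τ) (hu1 : 0 < u 1) {n : ℕ}
    (hn : 1 ≤ n) (τ : Cut h) : 0 < (columnTransfer d D 2 h sw ^ n).mulVec u τ := by
  obtain ⟨n, rfl⟩ := Nat.exists_eq_add_of_le' hn
  rw [pow_succ', ← Matrix.mulVec_mulVec]
  refine Finset.sum_pos' (fun θ _ => mul_nonneg (columnTransfer_nonneg hd hD _ _ _)
      (mulVec_nonneg hd hD sw hu n θ)) ⟨1, Finset.mem_univ _, mul_pos ?_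
        (mulVec_one_pos hd hD sw hu hu1 n)⟩
  rw [columnTransfer_eq_column]
  exact column_sw_one_pos hd hD _ _

lemma le_mulVec_lowest {k : ℕ} {u : Cut (k + 1) → ℝ} (hu : ∀ τ, 0 ≤ u τ) (r : ℕ) :
    subleading d D ^ r * u (lowest k) ≤
      (columnTransfer d D 2 (k + 1) 1 ^ r).mulVec u (lowest k) := by
  induction r with
  | zero => simp
  | succ r ih =>
    have hs := subleading_pos hd hD
    have h : subleading d D * (columnTransfer d D 2 (k + 1) 1 ^ r).mulVec u (lowest k) ≤
        (columnTransfer d D 2 (k + 1) 1 ^ (r + 1)).mulVec u (lowest k) := by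
      conv_lhs => rw [← columnTransfer_lowest hd hD k]
      rw [pow_succ', ← Matrix.mulVec_mulVec]
      exact Finset.single_le_sum (f := fun θ => columnTransfer d D 2 (k + 1) 1 (lowest k) θ *
        (columnTransfer d D 2 (k + 1) 1 ^ r).mulVec u θ)
        (fun θ _ => mul_nonneg (columnTransfer_nonneg hd hD _ _ _)
          (mulVec_nonneg hd hD 1 hu r θ)) (Finset.mem_univ _)
    refine le_trans ?_ h
    rw [pow_succ', mul_assoc]
    exact mul_le_mul_of_nonneg_left ih hs.le

/-- At the cut `lowest`, `vac` vanishes and `subVec` is 1, so that entry of `T ^ r u` is `b λ₂ ^ r`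
up to the error. Nonnegativity and the diagonal entry `λ₂` bound it below by `λ₂ ^ r u (lowest k)`.
-/
lemma coeff_pos {χ : ℝ} (hχ1 : subleading d D * contraction d D < χ)
    (hχ2 : χ < subleading d D) {k : ℕ} {u : Cut (k + 1) → ℝ} (hu : ∀ τ, 0 < u τ) {a b : ℝ}
    (h : ∀ τ, (fun r : ℕ => (columnTransfer d D 2 (k + 1) 1 ^ r).mulVec u τ -
      a * vac (k + 1) τ - b * subleading d D ^ r * subVec d D k τ)
      =O[atTop] fun r : ℕ => χ ^ r) : 0 < b := by
  have hs := subleading_pos hd hD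
  have hχ0 : 0 < χ := (mul_pos hs (contraction_pos hd hD)).trans hχ1
  obtain ⟨C, hC, hb⟩ := bound_of_isBigO_nat_atTop (h (lowest k))
  have h0 : vac (k + 1) (lowest k) = 0 := Pi.single_eq_of_ne (lowest_ne_one k) _
  have h1 : ∀ r : ℕ, u (lowest k) - C * (χ / subleading d D) ^ r ≤ b := by
    intro r
    have e1 := hb (pow_pos hχ0 r).ne'
    rw [h0, subVec_lowest, mul_zero, sub_zero, mul_one, Real.norm_of_nonneg (pow_pos hχ0 r).le]
      at e1
    have e2 := (le_abs_self _).trans e1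
    have e3 := le_mulVec_lowest hd hD (fun τ => (hu τ).le) r
    have hp := pow_pos hs r
    rw [div_pow, ← mul_le_mul_iff_left₀ hp, sub_mul, mul_assoc, div_mul_cancel₀ _ hp.ne']
    linarith
  have h2 : Tendsto (fun r : ℕ => u (lowest k) - C * (χ / subleading d D) ^ r) atTop
      (𝓝 (u (lowest k) - C * 0)) :=
    ((tendsto_pow_atTop_nhds_zero_of_lt_one (by positivity)
      ((div_lt_one hs).mpr hχ2)).const_mul C).const_sub _
  rw [mul_zero, sub_zero] at h2
  exact (hu _).trans_le (le_of_tendsto' h2 h1)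

end

/-! ### Exponential decay -/

lemma isBigO_log_one_add {y : ℕ → ℝ} {lam χ κ : ℝ} (hlam0 : 0 < lam) (hlam1 : lam < 1)
    (hχ : χ < lam) (hχ2 : lam ^ 2 ≤ χ)
    (h : (fun r => y r - κ * lam ^ r) =O[atTop] fun r : ℕ => χ ^ r) :
    (fun r => Real.log (1 + y r) - κ * lam ^ r) =O[atTop] fun r : ℕ => χ ^ r := by
  have hχ0 : 0 < χ := (pow_pos hlam0 2).trans_le hχ2
  have h1 : y =O[atTop] fun r : ℕ => lam ^ r := by
    have e1 : (fun r : ℕ => χ ^ r) =O[atTop] fun r : ℕ => lam ^ r :=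
      IsBigO.of_bound 1 (Eventually.of_forall fun r => by
        rw [one_mul, Real.norm_of_nonneg (pow_pos hχ0 r).le,
          Real.norm_of_nonneg (pow_pos hlam0 r).le]
        exact pow_le_pow_left₀ hχ0.le hχ.le r)
    exact ((h.trans e1).add (isBigO_const_mul_self κ (fun r : ℕ => lam ^ r) atTop)).congr_left
      fun r => by ring
  have h2 : Tendsto y atTop (𝓝 0) :=
    h1.trans_tendsto (tendsto_pow_atTop_nhds_zero_of_lt_one hlam0.le hlam1)
  have h3 : (fun r => Real.log (1 + y r) - y r) =O[atTop] fun r => y r ^ 2 := by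
    refine IsBigO.of_bound 2 ?_
    have h4 : ∀ᶠ r in atTop, |y r| < 1 / 2 := by
      have := h2.abs
      rw [abs_zero] at this
      exact this.eventually (gt_mem_nhds (by norm_num))
    filter_upwards [h4] with r hr
    -- The first-order Taylor bound has error `|y|² / (1 - |y|)`, at most `2 y²` once `|y| < 1 / 2`.
    have := Real.abs_log_sub_add_sum_range_le (x := - y r) (by rw [abs_neg]; linarith) 1
    simp at this
    rw [Real.norm_eq_abs, Real.norm_eq_abs, abs_of_nonneg (sq_nonneg (y r))]
    have e : Real.log (1 + y r) - y r = - y r + Real.log (1 + y r) := by ring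
    rw [e]
    refine this.trans ?_
    rw [div_le_iff₀ (by linarith)]
    nlinarith [sq_nonneg (y r)]
  have h5 : (fun r => y r ^ 2) =O[atTop] fun r : ℕ => χ ^ r := by
    refine (h1.pow 2).trans (IsBigO.of_bound 1 (Eventually.of_forall fun r => ?_))
    rw [one_mul, Real.norm_of_nonneg (by positivity), Real.norm_of_nonneg (pow_pos hχ0 r).le,
      ← pow_mul, mul_comm r 2, pow_mul]
    exact pow_le_pow_left₀ (by positivity) hχ2 r
  exact ((h3.trans h5).add h).congr_left fun r => by ring

lemma decaysExponentially_of_isBigO {d D : ℕ} (hd : 2 ≤ d) (hD : 2 ≤ D) {I : ℕ → ℝ} {χ κ : ℝ}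
    (hχ0 : 0 < χ) (hχ : χ < subleading d D) (hκ : κ ≠ 0)
    (h : (fun r => I r - κ * subleading d D ^ r) =O[atTop] fun r : ℕ => χ ^ r) :
    DecaysExponentially I (xi2D d D) := by
  have hs := subleading_pos hd hD
  have hs1 := subleading_lt_one hd hD
  have hlog1 := Real.log_neg hs hs1
  have hlog2 := Real.log_neg hχ0 (hχ.trans hs1)
  have hexp : ∀ {z : ℝ}, 0 < z → ∀ r : ℕ, Real.exp (-(r : ℝ) / -(Real.log z)⁻¹) = z ^ r := by
    intro z hz r
    rw [neg_div_neg_eq, div_inv_eq_mul, mul_comm, Real.exp_mul, Real.exp_log hz, Real.rpow_natCast]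
  refine ⟨κ, -(Real.log χ)⁻¹, hκ, neg_pos.mpr (inv_lt_zero.mpr hlog2), ?_, ?_⟩
  · rw [xi2D, neg_lt_neg_iff]
    exact (inv_lt_inv_of_neg hlog1 hlog2).mpr (Real.log_lt_log hχ0 hχ)
  · simp only [xi2D, hexp hs, hexp hχ0]
    exact h

/-- The limit of infinitely many columns before the first block, and its exponential decay. -/
theorem exists_limit_decaysExponentially {d D : ℕ} [NeZero d] [NeZero D] (hd : 2 ≤ d)
    (hD : 2 ≤ D) {h a b : ℕ} (hh : 1 ≤ h) (ha : 1 ≤ a) (hb : 1 ≤ b) :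
    ∃ I : ℕ → ℝ,
      (∀ m f : ℕ, h < m → 1 ≤ f → ∀ r : ℕ,
        Tendsto
          (fun c : ℕ => annealedMutualInfo d D m (c + a + r + b + f)
            (block m (c + a + r + b + f) h c a)
            (block m (c + a + r + b + f) h (c + a + r) b))
          atTop (𝓝 (I r))) ∧
      DecaysExponentially I (xi2D d D) := by
  obtain ⟨k, rfl⟩ := Nat.exists_eq_add_of_le' hh
  obtain ⟨ℓ, hℓ, hlim⟩ := exists_stationary hd hD k
  obtain ⟨χ, hχ1, hχ2, hχ3⟩ := exists_rate hd hD
  have hs := subleading_pos hd hD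
  have hs1 := subleading_lt_one hd hD
  have hχ0 : 0 < χ := (mul_pos hs (contraction_pos hd hD)).trans hχ1
  set T := columnTransfer d D 2 (k + 1) 1 with hT
  set S := columnTransfer d D 2 (k + 1) sw with hS
  have hv0 : ∀ τ, 0 ≤ vac (k + 1) τ := fun τ => by
    by_cases h : τ = 1 <;> simp [h]
  have hv1 : 0 < vac (k + 1) 1 := by simp
  set u := (S ^ b).mulVec (vac (k + 1)) with hu
  -- One column of `B` suffices: the column of `S` indexed by the trivial cut is strictly positive.
  have hupos : ∀ τ, 0 < u τ := mulVec_sw_pos hd hD hv0 hv1 hb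
  obtain ⟨a₀, b₀, hab⟩ := exists_isBigO_pow hd hD hχ1 hχ2 k u
  have ha₀ : a₀ = ℓ ⬝ᵥ u :=
    tendsto_nhds_unique (tendsto_of_isBigO_pow hd hD hχ1 hχ2 hab) (hlim u)
  have hb₀ : 0 < b₀ := coeff_pos hd hD hχ1 hχ2 hupos hab
  set G := Matrix.vecMul ℓ (S ^ a) with hG
  have hGt : IsTame D G := hℓ.vecMul_pow hd hD sw a
  -- One factor `S` of the block `A` acts on `subVec`; the remaining ones stay in the tame row
  -- vector.
  have hGsub : 0 < G ⬝ᵥ subVec d D k := by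
    obtain ⟨a', rfl⟩ := Nat.exists_eq_add_of_le' ha
    rw [hG, pow_succ, ← Matrix.vecMul_vecMul, ← Matrix.dotProduct_mulVec]
    exact (hℓ.vecMul_pow hd hD sw a').dotProduct_pos hd hD
  have hPA : 0 < G ⬝ᵥ vac (k + 1) := hGt.dotProduct_pos_of_nonneg hv0 hv1
  have hPB : 0 < ℓ ⬝ᵥ u := hℓ.dotProduct_pos_of_nonneg (fun τ => (hupos τ).le) (hupos 1)
  have hPAB : ∀ r, 0 < G ⬝ᵥ (T ^ r).mulVec u := fun r =>
    hGt.dotProduct_pos_of_nonneg (mulVec_nonneg hd hD 1 (fun τ => (hupos τ).le) r)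
      (mulVec_one_pos hd hD 1 (fun τ => (hupos τ).le) (hupos 1) r)
  refine ⟨fun r => - Real.log (G ⬝ᵥ vac (k + 1)) + - Real.log (ℓ ⬝ᵥ u) -
    - Real.log (G ⬝ᵥ (T ^ r).mulVec u), fun m f hm hf r => ?_, ?_⟩
  · have eA : ∀ c, expectedPurity d D m (c + a + r + b + f)
        (block m (c + a + r + b + f) (k + 1) c a) =
        Matrix.vecMul 1 (T ^ c) ⬝ᵥ (S ^ a).mulVec (vac (k + 1)) := by
      intro c
      rw [expectedPurity_two_blocks hd hD hm hf (fun j => decide (c ≤ j ∧ j < c + a))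
        (block m (c + a + r + b + f) (k + 1) c a) (x := sw) (y := 1) (by simp [block])
        (fun j hj => by simp; omega) (fun j h1 h2 => by simp [h1, h2])
        (fun j h1 h2 => by simp; omega) (fun j h1 h2 => by simp; omega)
        (fun j h1 => by simp; omega), columnTransfer_pow_mulVec_vac hd hD,
        columnTransfer_pow_mulVec_vac hd hD]
    have eB : ∀ c, expectedPurity d D m (c + a + r + b + f)
        (block m (c + a + r + b + f) (k + 1) (c + a + r) b) =
        Matrix.vecMul 1 (T ^ (c + (a + r))) ⬝ᵥ u := by
      intro c
      rw [expectedPurity_two_blocks hd hD hm hf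
        (fun j => decide (c + a + r ≤ j ∧ j < c + a + r + b))
        (block m (c + a + r + b + f) (k + 1) (c + a + r) b) (x := 1) (y := sw) (by simp [block])
        (fun j hj => by simp; omega) (fun j h1 h2 => by simp; omega)
        (fun j h1 h2 => by simp; omega) (fun j h1 h2 => by simp [h1, h2])
        (fun j h1 => by simp; omega)]
      rw [Matrix.dotProduct_mulVec, Matrix.dotProduct_mulVec, Matrix.vecMul_vecMul,
        Matrix.vecMul_vecMul, ← pow_add, ← pow_add]
    have eAB : ∀ c, expectedPurity d D m (c + a + r + b + f)
        (block m (c + a + r + b + f) (k + 1) c a ∪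
          block m (c + a + r + b + f) (k + 1) (c + a + r) b) =
        Matrix.vecMul 1 (T ^ c) ⬝ᵥ (S ^ a).mulVec ((T ^ r).mulVec u) := by
      intro c
      rw [expectedPurity_two_blocks hd hD hm hf
        (fun j => decide ((c ≤ j ∧ j < c + a) ∨ (c + a + r ≤ j ∧ j < c + a + r + b)))
        _ (x := sw) (y := sw) (by simp [block]; tauto)
        (fun j hj => by simp; omega) (fun j h1 h2 => by simp [h1, h2])
        (fun j h1 h2 => by simp; omega) (fun j h1 h2 => by simp [h1, h2])
        (fun j h1 => by simp; omega)]
    simp only [annealedMutualInfo, annealedRenyiTwo, eA, eB, eAB]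
    refine (Tendsto.add ?_ ?_).sub ?_
    · rw [hG, ← Matrix.dotProduct_mulVec] at hPA ⊢
      exact ((hlim _).log hPA.ne').neg
    · exact (((hlim u).comp (tendsto_add_atTop_nat (a + r))).log hPB.ne').neg
    · have hp := hPAB r
      rw [hG, ← Matrix.dotProduct_mulVec] at hp ⊢
      exact ((hlim _).log hp.ne').neg
  · have hGO : (fun r : ℕ => G ⬝ᵥ (T ^ r).mulVec u - a₀ * (G ⬝ᵥ vac (k + 1)) -
        b₀ * subleading d D ^ r * (G ⬝ᵥ subVec d D k)) =O[atTop] fun r : ℕ => χ ^ r := by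
      have := IsBigO.fun_sum (s := Finset.univ) fun τ _ => (hab τ).const_mul_left (G τ)
      refine this.congr_left fun r => ?_
      simp only [dotProduct, Finset.mul_sum, ← Finset.sum_sub_distrib]
      exact Finset.sum_congr rfl fun τ _ => by ring
    set P := (G ⬝ᵥ vac (k + 1)) * (ℓ ⬝ᵥ u) with hP
    have hP0 : 0 < P := mul_pos hPA hPB
    -- Since `a₀ = ℓ ⬝ u`, the constant term of the joint purity is exactly `P`. Dividing by `P`
    -- leaves this amplitude of `λ₂ ^ r`.
    refine decaysExponentially_of_isBigO hd hD hχ0 hχ2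
      (κ := b₀ * (G ⬝ᵥ subVec d D k) / P) (by positivity) ?_
    have hlog : ∀ r, - Real.log (G ⬝ᵥ vac (k + 1)) + - Real.log (ℓ ⬝ᵥ u) -
        - Real.log (G ⬝ᵥ (T ^ r).mulVec u) =
        Real.log (1 + (G ⬝ᵥ (T ^ r).mulVec u / P - 1)) := by
      intro r
      rw [add_sub_cancel, Real.log_div (hPAB r).ne' hP0.ne', hP,
        Real.log_mul hPA.ne' hPB.ne']
      ring
    simp only [hlog]
    refine isBigO_log_one_add hs hs1 hχ2 hχ3 ?_
    refine (hGO.const_mul_left P⁻¹).congr_left fun r => ?_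
    rw [ha₀]
    have : P⁻¹ * P = 1 := inv_mul_cancel₀ hP0.ne'
    rw [div_eq_mul_inv, div_eq_mul_inv]
    linear_combination (-1 : ℝ) * this

end

end IsoTNS

end

theorem mainTheorem4 (d D : ℕ) [NeZero d] [NeZero D] (hd : 2 ≤ d) (hD : 2 ≤ D)
    (h a b : ℕ) (hh : 1 ≤ h) (ha : 1 ≤ a) (hb : 1 ≤ b) :
    -- spectrum of the transfer matrix for the trivial permutation of two replicas
    ((0 < IsoTNS.subleading d D ∧ IsoTNS.subleading d D < 1) ∧
      (((IsoTNS.columnTransfer d D 2 h 1).map (algebraMap ℝ ℂ)).charpoly.rootMultiplicity 1 = 1) ∧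
      (((IsoTNS.columnTransfer d D 2 h 1).map (algebraMap ℝ ℂ)).charpoly.rootMultiplicity
        (IsoTNS.subleading d D : ℂ) = 1) ∧
      (∀ z : ℂ, ((IsoTNS.columnTransfer d D 2 h 1).map (algebraMap ℝ ℂ)).charpoly.IsRoot z →
        z = 1 ∨ z = (IsoTNS.subleading d D : ℂ) ∨ ‖z‖ < IsoTNS.subleading d D)) ∧
    -- exponential decay, in the limit of infinitely many columns before the first block
    (∃ I : ℕ → ℝ,
      (∀ m f : ℕ, h < m → 1 ≤ f → ∀ r : ℕ,
        Filter.Tendsto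
          (fun c : ℕ => IsoTNS.annealedMutualInfo d D m (c + a + r + b + f)
            (IsoTNS.block m (c + a + r + b + f) h c a)
            (IsoTNS.block m (c + a + r + b + f) h (c + a + r) b))
          Filter.atTop (nhds (I r))) ∧
      IsoTNS.DecaysExponentially I (IsoTNS.xi2D d D)) :=
  ⟨⟨⟨IsoTNS.subleading_pos hd hD, IsoTNS.subleading_lt_one hd hD⟩,
    IsoTNS.spectrum_columnTransfer hd hD h hh⟩,
    IsoTNS.exists_limit_decaysExponentially hd hD hh ha hb⟩
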